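/- Let $\Delta, c_1, c_2, c_3$ be positive real numbers with $\frac{c_2}{c_1}\Delta^2\le \frac53$, and let $\nu$ be the measure supported in $[-\Delta,\Delta]$ given there by $d\nu(\alpha)=c_1\boldsymbol{\delta}(\alpha)+c_2|\alpha|e^{-c_3|\alpha|}\,d\alpha$, where $\boldsymbol\delta$ is the unit point mass at $0$; put $\widehat\nu(x)=\int e^{-2\pi i x\alpha}\,d\nu(\alpha)$. Let $\mathcal H_\nu$ be the space of entire functions $f$ of exponential type at most $\pi\Delta$ (that is, for every $\varepsilon>0$ there is $C_\varepsilon$ with $|f(z)|\le C_\varepsilon e^{(\pi\Delta+\varepsilon)|z|}$ for all $z\in\mathbb C$) such that $\int_{\mathbb R}|f(x)|^2\,\widehat\nu(x)\,dx<\infty$, with inner product $\langle f,g\rangle_\nu=\int_{\mathbb R}f(x)\overline{g(x)}\,\widehat\nu(x)\,dx$. Then $\mathcal H_\nu$ has a unique reproducing kernel $K_\nu:\mathbb C^2\to\mathbb C$, that is, a unique function with $K_\nu(w,\cdot)\in\mathcal H_\nu$ and $f(w)=\langle f,K_\nu(w,\cdot)\rangle_\nu$ for all $w\in\mathbb C$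 and $f\in\mathcal H_\nu$, and its value at $(0,0)$ is given as follows. For $\eta\in\mathbb C$ put $$A(\eta)=1+\frac{c_2}{c_1}\int_{-\Delta/2}^{\Delta/2}\cosh(\eta\alpha)\,|\alpha|\,e^{-c_3|\alpha|}\,d\alpha,$$ $$B(\eta)=\eta^2+2\frac{c_2}{c_1}-c_3^2-2\frac{c_2c_3}{c_1}\int_{-\Delta/2}^{\Delta/2}\cosh(\eta\alpha)\,e^{-c_3|\alpha|}\,d\alpha.$$ Let $\eta_1,\eta_2\in\mathbb C$ be roots of $$c_1\eta^4+2(c_2-c_1c_3^2)\eta^2+c_3^2(2c_2+c_1c_3^2)=0$$ with $\eta_1+\eta_2\ne0$, where $\eta_1=\eta_2$ is allowed only if this is a multiple root. If $\eta_1\neq\eta_2$, then $A(\eta_1)B(\eta_2)-B(\eta_1)A(\eta_2)\ne0$ and $$\begin{aligned}K_\nu(0,0)={}&\frac{2}{A(\eta_1)B(\eta_2)-B(\eta_1)A(\eta_2)}\left(\frac1{c_1}-\frac{A(0)c_3^2}{2c_2+c_3^2c_1}\right)\left(\frac{\sinh\frac{\Delta\eta_1}{2}}{\eta_1}B(\eta_2)-\frac{\sinh\frac{\Delta\eta_2}{2}}{\eta_2}B(\eta_1)\right)\\&+\frac{2}{A(\eta_1)B(\eta_2)-B(\eta_1)A(\eta_2)}\left(\frac{c_3^2}{c_1}+\frac{B(0)c_3^2}{2c_2+c_3^2c_1}\right)\left(\frac{\sinh\frac{\Delta\eta_1}{2}}{\eta_1}A(\eta_2)-\frac{\sinh\frac{\Delta\eta_2}{2}}{\eta_2}A(\eta_1)\right)\\&+\frac{\Delta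 c_3^2}{2c_2+c_3^2c_1}.\end{aligned}$$ If $\eta_1=\eta_2$ is a multiple root, $K_\nu(0,0)$ is the limit of the right-hand side, with $(\eta_1,\eta_2)$ replaced by $(x,y)\in\mathbb C^2$, as $(x,y)\to(\eta_1,\eta_2)$ with $x\neq y$, and $A(x)B(y)-B(x)A(y)\neq0$ for all such $(x,y)$ sufficiently close to $(\eta_1,\eta_2)$. -/

import Mathlib

open MeasureTheory Filter Topology

noncomputable section

/-- The measure `c₁ δ + c₂ |α| e^{-c₃ |α|} dα`, supported in `[-Δ, Δ]`. -/
def nuMeasure (Δ c₁ c₂ c₃ : ℝ) : Measure ℝ :=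
  ENNReal.ofReal c₁ • Measure.dirac (0 : ℝ) +
    (volume.restrict (Set.Icc (-Δ) Δ)).withDensity
      (fun α : ℝ => ENNReal.ofReal (c₂ * |α| * Real.exp (-c₃ * |α|)))

/-- The Fourier transform `x ↦ ∫ e^{-2πi x α} dν(α)` of a measure on the line. -/
def nuHat (ν : Measure ℝ) (x : ℝ) : ℂ :=
  ∫ α : ℝ, Complex.exp (-2 * Real.pi * Complex.I * x * α) ∂ν

/-- `f` has exponential type at most `τ`. -/
def HasExpTypeLE (τ : ℝ) (f : ℂ → ℂ) : Prop :=
  ∀ ε : ℝ, 0 < ε → ∃ C : ℝ, ∀ z : ℂ, ‖f z‖ ≤ C * Real.exp ((τ + ε) * ‖z‖)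

/-- The inner product `∫ f(x) conj (g(x)) ν̂(x) dx` over the real line. -/
def nuInner (ν : Measure ℝ) (f g : ℂ → ℂ) : ℂ :=
  ∫ x : ℝ, f x * (starRingEnd ℂ) (g x) * nuHat ν x

/-- The space `H_ν`: entire functions of exponential type at most `πΔ` for which
`∫ |f(x)|² ν̂(x) dx` is finite. -/
def spaceH (Δ : ℝ) (ν : Measure ℝ) : Set (ℂ → ℂ) :=
  {f | Differentiable ℂ f ∧ HasExpTypeLE (Real.pi * Δ) f ∧
    Integrable (fun x : ℝ => ((‖f x‖ ^ 2 : ℝ) : ℂ) * nuHat ν x)}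

/-- `K` is a reproducing kernel of `H_ν`: `K(w, ·) ∈ H_ν` and `f(w) = ⟨f, K(w, ·)⟩_ν` for all
`f ∈ H_ν` and all `w ∈ ℂ`. -/
def IsReproducingKernel (Δ : ℝ) (ν : Measure ℝ) (K : ℂ → ℂ → ℂ) : Prop :=
  (∀ w : ℂ, K w ∈ spaceH Δ ν) ∧
    ∀ f ∈ spaceH Δ ν, ∀ w : ℂ, f w = nuInner ν f (K w)

/-- `A(η) = 1 + (c₂/c₁) ∫_{-Δ/2}^{Δ/2} cosh(ηα) |α| e^{-c₃|α|} dα`. -/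
def auxA (Δ c₁ c₂ c₃ : ℝ) (η : ℂ) : ℂ :=
  1 + (c₂ / c₁ : ℂ) * ∫ α in (-Δ / 2)..(Δ / 2),
    Complex.cosh (η * (α : ℂ)) * ((|α| * Real.exp (-c₃ * |α|) : ℝ) : ℂ)

/-- `B(η) = η² + 2c₂/c₁ - c₃² - 2(c₂c₃/c₁) ∫_{-Δ/2}^{Δ/2} cosh(ηα) e^{-c₃|α|} dα`. -/
def auxB (Δ c₁ c₂ c₃ : ℝ) (η : ℂ) : ℂ :=
  η ^ 2 + 2 * (c₂ / c₁ : ℂ) - (c₃ : ℂ) ^ 2 -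
    2 * (c₂ * c₃ / c₁ : ℂ) * ∫ α in (-Δ / 2)..(Δ / 2),
      Complex.cosh (η * (α : ℂ)) * ((Real.exp (-c₃ * |α|) : ℝ) : ℂ)

/-- The determinant `A(x) B(y) - B(x) A(y)`. -/
def detAB (Δ c₁ c₂ c₃ : ℝ) (x y : ℂ) : ℂ :=
  auxA Δ c₁ c₂ c₃ x * auxB Δ c₁ c₂ c₃ y - auxB Δ c₁ c₂ c₃ x * auxA Δ c₁ c₂ c₃ y

/-- The explicit expression for `K_ν(0,0)`, as a function of the two parameters `η₁ = x` and
`η₂ = y`. -/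
def kernelExpr (Δ c₁ c₂ c₃ : ℝ) (x y : ℂ) : ℂ :=
  2 / detAB Δ c₁ c₂ c₃ x y *
      (1 / (c₁ : ℂ) - auxA Δ c₁ c₂ c₃ 0 * (c₃ : ℂ) ^ 2 / (2 * c₂ + (c₃ : ℂ) ^ 2 * c₁)) *
      (Complex.sinh (Δ * x / 2) / x * auxB Δ c₁ c₂ c₃ y -
        Complex.sinh (Δ * y / 2) / y * auxB Δ c₁ c₂ c₃ x) +
    2 / detAB Δ c₁ c₂ c₃ x y *
      ((c₃ : ℂ) ^ 2 / c₁ + auxB Δ c₁ c₂ c₃ 0 * (c₃ : ℂ) ^ 2 / (2 * c₂ + (c₃ : ℂ) ^ 2 * c₁)) *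
      (Complex.sinh (Δ * x / 2) / x * auxA Δ c₁ c₂ c₃ y -
        Complex.sinh (Δ * y / 2) / y * auxA Δ c₁ c₂ c₃ x) +
    Δ * (c₃ : ℂ) ^ 2 / (2 * c₂ + (c₃ : ℂ) ^ 2 * c₁)

/-- The polynomial `c₁ X⁴ + 2(c₂ - c₁c₃²) X² + c₃²(2c₂ + c₁c₃²)`. -/
def charPoly (c₁ c₂ c₃ : ℝ) : Polynomial ℂ :=
  Polynomial.C (c₁ : ℂ) * Polynomial.X ^ 4 +
    Polynomial.C (2 * ((c₂ : ℂ) - c₁ * (c₃ : ℂ) ^ 2)) * Polynomial.X ^ 2 +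
    Polynomial.C ((c₃ : ℂ) ^ 2 * (2 * c₂ + c₁ * (c₃ : ℂ) ^ 2))

end

/-!
# The reproducing kernel of a de Branges space with an exponential weight

Write `h = Δ/2`, `I = [-h, h]` and `k(α) = |α| e^{-c₃|α|}`.

*The space.* The hypothesis `c₂ Δ² / c₁ ≤ 5/3` makes `ν̂` bounded away from zero
(`le_nuHatReal`): a lower bound for `∫₀ˢ a cos(ωa) da` survives the decreasing factor `e^{-c₃a}`, and
without that factor the claim is `u sin u + cos u - 1 ≥ -(0.2995) u²`
(`mul_sin_add_cos_ge`), and `2 · 5/3 · 0.2995 < 1`.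
Hence the elements of `H_ν` are the entire functions of exponential type at most `πΔ` that are
square integrable on the line. By the Paley–Wiener theorem these are exactly the functions
`f(z) = ∫_I e^{-2πizα} ψ(α) dα` with `ψ ∈ L²(I)` (`mem_spaceH_iff`). Paley–Wiener is proved by
rotating the half-line of integration in `∫_0^∞ f(x) e^{-wx} dx` to the imaginary axis
(`integral_Ioi_eq_rotated`), which shows that the Fourier transforms of `f(x) e^{-ε|x|}` tend to
zero outside `I`.

*The kernel.* In terms of `ψ` the inner product of `H_ν` is `⟪T φ, ψ⟫`, where `T` is the
compression to `L²(I)` of the Fourier multiplier `ν̂` (`inner_toeplitz_eq_integral`). `T` is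
coercive, so it is invertible, and `K_w` corresponds to the solution of `T φ = conj e^{-2πiwα}`.
On continuous functions `T` is the operator `u ↦ c₁ u + c₂ ∫_I k(· - β) u(β) dβ`
(`toeplitz_toLp_ae_eq`), so `K(0,0) = ∫_I u` for any continuous solution `u` of `T u = 1`.

*The value at the origin.* An explicit integration (`convOp_cosh`) gives, for `η² ≠ c₃²`,
`T(cosh η·) = c₁ A(η) cosh(c₃α) + c₁ B(η) α sinh(c₃α) / (2c₃) + P(η) Q(η, α)`, where `P` is the
characteristic polynomial. At a root of `P` the last term drops out; at a double root the same
holds for the derivative in `η`, i.e. for `α sinh(ηα)` with `A'`, `B'` in place of `A`, `B`.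
The case `η = 0` takes care of constants. Solving a `2 × 2` linear system yields `u`, a
combination of `1` and of two such functions (`det_ne_zero_and_kernel_value`); its determinant is
nonzero since `T` is injective and the two functions are linearly independent. For a double root
the value found is the limit of the formula for distinct parameters, because numerators and
determinant are antisymmetric and may be divided by `y - x` (`tendsto_antisymm_div`).
-/

noncomputable section

open scoped FourierTransform SchwartzMap InnerProductSpace ENNReal ComplexConjugate Convolution

/-! ### The Fourier transform on `L¹ ∩ L²` -/

theorem integral_fourier_mul_eq_mul_fourier {u v : ℝ → ℂ} (hu : Integrable u)
    (hv : Integrable v) : ∫ x, 𝓕 u x * v x = ∫ x, u x * 𝓕 v x := by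
  have h := VectorFourier.integral_fourierIntegral_smul_eq_flip (L := innerₗ ℝ)
    Real.continuous_fourierChar (by fun_prop) hu hv
  rw [flip_innerₗ] at h
  exact h

/-- The `L²` Fourier transform of a function in `L¹ ∩ L²` is the one given by the integral: both
agree when tested against Schwartz functions. -/
theorem fourier_toLp_ae_eq {g : ℝ → ℂ} (h1 : Integrable g) (h2 : MemLp g 2) :
    ((𝓕 (h2.toLp g) : Lp ℂ 2 (volume : Measure ℝ)) : ℝ → ℂ) =ᵐ[volume] 𝓕 g := by
  have hcont : Continuous (𝓕 g) :=
    VectorFourier.fourierIntegral_continuous Real.continuous_fourierChar (by fun_prop) h1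
  refine ae_eq_of_integral_contDiff_smul_eq
    ((Lp.memLp _).locallyIntegrable (by norm_num)) hcont.locallyIntegrable fun φ hφ hφc => ?_
  have hc : HasCompactSupport (fun x => (φ x : ℂ)) := hφc.comp_left (g := Complex.ofReal) (by simp)
  let Φ : 𝓢(ℝ, ℂ) := hc.toSchwartzMap (Complex.ofRealCLM.contDiff.comp hφ)
  have hΦ : ∀ x, Φ x = (φ x : ℂ) := fun x => rfl
  have hΦi : Integrable Φ volume := Φ.integrable
  have key : ((𝓕 (h2.toLp g) : Lp ℂ 2 (volume : Measure ℝ)) : 𝓢'(ℝ, ℂ)) Φ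
      = ∫ x, (𝓕 Φ) x • (h2.toLp g) x := by
    rw [← Lp.fourier_toTemperedDistribution_eq, TemperedDistribution.fourier_apply,
      Lp.toTemperedDistribution_apply]
  rw [Lp.toTemperedDistribution_apply] at key
  suffices h : ∫ x, Φ x • ((𝓕 (h2.toLp g) : Lp ℂ 2 (volume : Measure ℝ)) : ℝ → ℂ) x =
      ∫ x, Φ x • (𝓕 g) x by simpa [hΦ] using h
  calc _ = ∫ x, (𝓕 Φ) x • (h2.toLp g) x := key
    _ = ∫ x, (𝓕 Φ) x • g x := by
        refine integral_congr_ae ?_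
        filter_upwards [h2.coeFn_toLp] with x hx
        rw [hx]
    _ = ∫ x, Φ x • (𝓕 g) x := by
        rw [SchwartzMap.fourier_coe]
        exact integral_fourier_mul_eq_mul_fourier hΦi h1
    _ = _ := by rfl

/-- The analogue of `fourier_toLp_ae_eq` for the inverse transform. -/
theorem fourierInv_toLp_ae_eq {g : ℝ → ℂ} (h1 : Integrable g) (h2 : MemLp g 2) :
    ((𝓕⁻ (h2.toLp g) : Lp ℂ 2 (volume : Measure ℝ)) : ℝ → ℂ) =ᵐ[volume] 𝓕⁻ g := by
  have hcont : Continuous (𝓕⁻ g) := by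
    rw [Real.fourierInv_eq_fourier_comp_neg]
    exact VectorFourier.fourierIntegral_continuous Real.continuous_fourierChar (by fun_prop)
      h1.comp_neg
  refine ae_eq_of_integral_contDiff_smul_eq
    ((Lp.memLp _).locallyIntegrable (by norm_num)) hcont.locallyIntegrable fun φ hφ hφc => ?_
  have hc : HasCompactSupport (fun x => (φ x : ℂ)) := hφc.comp_left (g := Complex.ofReal) (by simp)
  let Φ : 𝓢(ℝ, ℂ) := hc.toSchwartzMap (Complex.ofRealCLM.contDiff.comp hφ)
  have hΦ : ∀ x, Φ x = (φ x : ℂ) := fun x => rfl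
  have hΦi : Integrable Φ volume := Φ.integrable
  have key : ((𝓕⁻ (h2.toLp g) : Lp ℂ 2 (volume : Measure ℝ)) : 𝓢'(ℝ, ℂ)) Φ
      = ∫ x, (𝓕⁻ Φ) x • (h2.toLp g) x := by
    rw [← Lp.fourierInv_toTemperedDistribution_eq, TemperedDistribution.fourierInv_apply,
      Lp.toTemperedDistribution_apply]
  rw [Lp.toTemperedDistribution_apply] at key
  suffices h : ∫ x, Φ x • ((𝓕⁻ (h2.toLp g) : Lp ℂ 2 (volume : Measure ℝ)) : ℝ → ℂ) x =
      ∫ x, Φ x • (𝓕⁻ g) x by simpa [hΦ] using h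
  calc _ = ∫ x, (𝓕⁻ Φ) x • (h2.toLp g) x := key
    _ = ∫ x, (𝓕⁻ Φ) x • g x := by
        refine integral_congr_ae ?_
        filter_upwards [h2.coeFn_toLp] with x hx
        rw [hx]
    _ = ∫ x, (𝓕 Φ) x • g (-x) := by
        rw [← integral_neg_eq_self]
        simp [SchwartzMap.fourierInv_coe, SchwartzMap.fourier_coe, Real.fourierInv_eq_fourier_neg]
    _ = ∫ x, Φ x • (𝓕 fun x => g (-x)) x := by
        rw [SchwartzMap.fourier_coe]
        exact integral_fourier_mul_eq_mul_fourier hΦi h1.comp_neg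
    _ = ∫ x, Φ x • (𝓕⁻ g) x := by simp [Real.fourierInv_eq_fourier_comp_neg]
    _ = _ := by rfl

/-! ### The Paley–Wiener theorem -/

/-- A Laplace transform is holomorphic in its half-plane of absolute convergence. -/
theorem differentiableOn_laplace {h : ℝ → ℂ} {s₀ : ℝ}
    (hm : AEStronglyMeasurable h (volume.restrict (Set.Ioi 0)))
    (hint : ∀ s : ℝ, s₀ < s →
      Integrable (fun x : ℝ => h x * Real.exp (-s * x)) (volume.restrict (Set.Ioi 0))) :
    DifferentiableOn ℂ (fun w : ℂ => ∫ x in Set.Ioi (0:ℝ), h x * Complex.exp (-w * x))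
      {w : ℂ | s₀ < w.re} := by
  intro w hw
  simp only [Set.mem_ofPred_eq] at hw
  set δ := (w.re - s₀) / 3 with hδ
  have hδ0 : 0 < δ := by rw [hδ]; linarith
  have hopen : IsOpen {v : ℂ | s₀ + 2 * δ < v.re} :=
    isOpen_lt continuous_const Complex.continuous_re
  have hmeas : ∀ v : ℂ, AEStronglyMeasurable (fun x : ℝ => h x * Complex.exp (-v * x))
      (volume.restrict (Set.Ioi 0)) := fun v =>
    hm.mul (by fun_prop : Continuous fun x : ℝ => Complex.exp (-v * x)).aestronglyMeasurable
  have key := hasDerivAt_integral_of_dominated_loc_of_deriv_le (μ := volume.restrict (Set.Ioi 0))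
    (F := fun (v : ℂ) (x : ℝ) => h x * Complex.exp (-v * x))
    (F' := fun (v : ℂ) (x : ℝ) => h x * (Complex.exp (-v * x) * (-x))) (x₀ := w)
    (bound := fun x => δ⁻¹ * ‖h x * Real.exp (-(s₀ + δ) * x)‖)
    (hopen.mem_nhds (by simp only [Set.mem_ofPred_eq]; rw [hδ]; linarith))
    (Eventually.of_forall hmeas) ?_ ?_ ?_ ?_ ?_
  · exact key.2.differentiableAt.differentiableWithinAt
  · refine (hint w.re hw).mono (hmeas w) (Eventually.of_forall fun x => ?_)
    simp [Complex.norm_exp]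
  · exact hm.mul (by fun_prop : Continuous fun x : ℝ =>
      Complex.exp (-w * x) * (-x : ℂ)).aestronglyMeasurable
  · filter_upwards [ae_restrict_mem measurableSet_Ioi] with x hx v hv
    simp only [Set.mem_Ioi] at hx hv
    have e1 : x ≤ δ⁻¹ * Real.exp (δ * x) := by
      rw [inv_mul_eq_div, le_div_iff₀ hδ0]
      linarith [Real.add_one_le_exp (δ * x), mul_comm x δ]
    have e2 : Real.exp (-v.re * x) ≤ Real.exp (-(s₀ + 2 * δ) * x) :=
      Real.exp_le_exp.2 (by nlinarith)
    have e3 : Real.exp (-(s₀ + δ) * x) = Real.exp (-(s₀ + 2 * δ) * x) * Real.exp (δ * x) := by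
      rw [← Real.exp_add]; ring_nf
    calc ‖h x * (Complex.exp (-v * x) * (-x))‖ = ‖h x‖ * (Real.exp (-v.re * x) * x) := by
          simp [Complex.norm_exp, abs_of_pos hx]
      _ ≤ ‖h x‖ * (Real.exp (-(s₀ + 2 * δ) * x) * (δ⁻¹ * Real.exp (δ * x))) := by gcongr
      _ = δ⁻¹ * ‖h x * Real.exp (-(s₀ + δ) * x)‖ := by
          rw [norm_mul, Complex.norm_real, Real.norm_eq_abs, abs_of_pos (Real.exp_pos _), e3]; ring
  · exact ((hint (s₀ + δ) (by linarith)).norm).const_mul _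
  · refine Eventually.of_forall fun x v _ => ?_
    have h1 : HasDerivAt (fun v : ℂ => -v * (x : ℂ)) (-x : ℂ) v := by
      simpa using (hasDerivAt_id v).neg.mul_const (x : ℂ)
    exact h1.cexp.const_mul _

theorem integrableOn_exp_neg_mul_Ioi {s : ℝ} (hs : 0 < s) :
    Integrable (fun x : ℝ => Real.exp (-s * x)) (volume.restrict (Set.Ioi 0)) := by
  exact exp_neg_integrableOn_Ioi 0 hs

theorem integrable_of_norm_le_exp {h : ℝ → ℂ} (hm : Continuous h) {C a : ℝ}
    (hb : ∀ x : ℝ, 0 < x → ‖h x‖ ≤ C * Real.exp (a * x)) {s : ℝ} (hs : a < s) :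
    Integrable (fun x : ℝ => h x * Real.exp (-s * x)) (volume.restrict (Set.Ioi 0)) := by
  refine ((integrableOn_exp_neg_mul_Ioi (sub_pos.2 hs)).const_mul C).mono
    (by fun_prop) ?_
  filter_upwards [ae_restrict_mem measurableSet_Ioi] with x hx
  rw [norm_mul, Complex.norm_real, Real.norm_eq_abs, abs_of_pos (Real.exp_pos _)]
  refine le_trans ?_ (le_abs_self _)
  calc _ ≤ C * Real.exp (a * x) * Real.exp (-s * x) := by gcongr; exact hb x hx
    _ = _ := by rw [mul_assoc, ← Real.exp_add]; ring_nf

/-- Rotation of the half-line of integration by a right angle. In this range of `w` the integrand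
decays exponentially in the whole first quadrant, and Cauchy's theorem on large squares applies. -/
theorem integral_Ioi_eq_rotated_of_large {f : ℂ → ℂ} (hf : Differentiable ℂ f) {C a : ℝ}
    (ha : 0 < a) (hb : ∀ z, ‖f z‖ ≤ C * Real.exp (a * ‖z‖)) {w : ℂ} (hre : 2 * a < w.re)
    (him : w.im < -(2 * a)) :
    ∫ x in Set.Ioi (0:ℝ), f x * Complex.exp (-w * x) =
      Complex.I * ∫ y in Set.Ioi (0:ℝ), f (Complex.I * y) * Complex.exp (-(Complex.I * w) * y) := by
  have hC : 0 ≤ C := by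
    have := (norm_nonneg _).trans (hb 0)
    simpa using this
  set F : ℂ → ℂ := fun z => f z * Complex.exp (-w * z) with hF
  have hFd : Differentiable ℂ F := by fun_prop
  have hFb : ∀ x y : ℝ, 0 ≤ x → 0 ≤ y → ‖F (x + y * Complex.I)‖ ≤ C * Real.exp (-a * (x + y)) := by
    intro x y hx hy
    have h1 : ‖(x + y * Complex.I : ℂ)‖ ≤ x + y := by
      refine (norm_add_le _ _).trans ?_
      simp [abs_of_nonneg hx, abs_of_nonneg hy]
    rw [hF]; simp only [norm_mul, Complex.norm_exp]
    calc _ ≤ (C * Real.exp (a * (x + y))) * Real.exp (-(2 * a) * (x + y)) := by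
          gcongr
          · exact (hb _).trans (by gcongr)
          · simp; nlinarith
      _ = _ := by rw [mul_assoc, ← Real.exp_add]; ring_nf
  have hint1 : IntegrableOn (fun x : ℝ => F x) (Set.Ioi 0) := by
    refine ((integrableOn_exp_neg_mul_Ioi ha).const_mul C).mono
      (hFd.continuous.comp Complex.continuous_ofReal).aestronglyMeasurable ?_
    filter_upwards [ae_restrict_mem measurableSet_Ioi] with x hx
    simpa using (hFb x 0 (le_of_lt hx) le_rfl).trans (le_abs_self _)
  have hint2 : IntegrableOn (fun y : ℝ => F (y * Complex.I)) (Set.Ioi 0) := by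
    refine ((integrableOn_exp_neg_mul_Ioi ha).const_mul C).mono
      (hFd.continuous.comp (by fun_prop : Continuous fun y : ℝ =>
        (y : ℂ) * Complex.I)).aestronglyMeasurable ?_
    filter_upwards [ae_restrict_mem measurableSet_Ioi] with x hx
    simpa using (hFb 0 x le_rfl (le_of_lt hx)).trans (le_abs_self _)
  have t1 := intervalIntegral_tendsto_integral_Ioi 0 hint1 tendsto_id
  have t2 := intervalIntegral_tendsto_integral_Ioi 0 hint2 tendsto_id
  have hsq : Tendsto (fun R : ℝ => R * (C * Real.exp (-a * R))) atTop (𝓝 0) := by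
    have h := (Real.tendsto_pow_mul_exp_neg_atTop_nhds_zero 1).comp (tendsto_id.const_mul_atTop ha)
    have h' := h.const_mul (C / a)
    simp only [mul_zero] at h'
    refine h'.congr fun R => ?_
    simp only [Function.comp, id, pow_one]
    field_simp
  have t3 : Tendsto (fun R : ℝ => ∫ x in (0:ℝ)..R, F (x + R * Complex.I)) atTop (𝓝 0) := by
    refine squeeze_zero_norm' ?_ hsq
    filter_upwards [eventually_ge_atTop 0] with R hR
    have := intervalIntegral.norm_integral_le_of_norm_le_const (a := 0) (b := R)
      (f := fun x : ℝ => F (x + R * Complex.I)) (C := C * Real.exp (-a * R)) fun x hx => by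
        rw [Set.uIoc_of_le hR] at hx
        refine (hFb x R hx.1.le hR).trans ?_
        exact mul_le_mul_of_nonneg_left (Real.exp_le_exp.2 (by nlinarith [hx.1])) hC
    simpa [abs_of_nonneg hR, mul_comm] using this
  have t4 : Tendsto (fun R : ℝ => ∫ y in (0:ℝ)..R, F (R + y * Complex.I)) atTop (𝓝 0) := by
    refine squeeze_zero_norm' ?_ hsq
    filter_upwards [eventually_ge_atTop 0] with R hR
    have := intervalIntegral.norm_integral_le_of_norm_le_const (a := 0) (b := R)
      (f := fun y : ℝ => F (R + y * Complex.I)) (C := C * Real.exp (-a * R)) fun x hx => by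
        rw [Set.uIoc_of_le hR] at hx
        refine (hFb R x hR hx.1.le).trans ?_
        exact mul_le_mul_of_nonneg_left (Real.exp_le_exp.2 (by nlinarith [hx.1])) hC
    simpa [abs_of_nonneg hR, mul_comm] using this
  have hrect : ∀ R : ℝ, (∫ x in (0:ℝ)..R, F x) - (∫ x in (0:ℝ)..R, F (x + R * Complex.I)) +
      Complex.I * (∫ y in (0:ℝ)..R, F (R + y * Complex.I)) -
      Complex.I * (∫ y in (0:ℝ)..R, F (y * Complex.I)) = 0 := by
    intro R
    have := Complex.integral_boundary_rect_eq_zero_of_differentiableOn F 0 (R + R * Complex.I)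
      hFd.differentiableOn
    simpa using this
  have tt := ((t1.sub t3).add (t4.const_mul Complex.I)).sub (t2.const_mul Complex.I)
  have h0 := tendsto_nhds_unique (tt.congr hrect) tendsto_const_nhds
  have e : ∫ y in Set.Ioi (0:ℝ), F (y * Complex.I) =
      ∫ y in Set.Ioi (0:ℝ), f (Complex.I * y) * Complex.exp (-(Complex.I * w) * y) := by
    refine integral_congr_ae (Eventually.of_forall fun y => ?_)
    simp only [hF]
    rw [mul_comm Complex.I (y : ℂ)]
    congr 2; ring
  rw [← e]
  linear_combination h0

/-- Rotation of the half-line of integration, in the common domain of the two Laplace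
transforms: both sides are holomorphic there, so `integral_Ioi_eq_rotated_of_large` extends to it. -/
theorem integral_Ioi_eq_rotated {f : ℂ → ℂ} (hf : Differentiable ℂ f) {C a : ℝ}
    (ha : 0 < a) (hb : ∀ z, ‖f z‖ ≤ C * Real.exp (a * ‖z‖))
    (hint : ∀ s : ℝ, 0 < s →
      Integrable (fun x : ℝ => f x * Real.exp (-s * x)) (volume.restrict (Set.Ioi 0)))
    {w : ℂ} (hre : 0 < w.re) (him : w.im < -a) :
    ∫ x in Set.Ioi (0:ℝ), f x * Complex.exp (-w * x) =
      Complex.I * ∫ y in Set.Ioi (0:ℝ), f (Complex.I * y) * Complex.exp (-(Complex.I * w) * y) := by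
  set U : Set ℂ := {w : ℂ | 0 < w.re} ∩ {w : ℂ | w.im < -a} with hU
  have hUo : IsOpen U := (isOpen_lt continuous_const Complex.continuous_re).inter
    (isOpen_lt Complex.continuous_im continuous_const)
  have hUc : Convex ℝ U := (convex_halfSpace_re_gt 0).inter (convex_halfSpace_im_lt (-a))
  have h1 : DifferentiableOn ℂ (fun w : ℂ => ∫ x in Set.Ioi (0:ℝ), f x * Complex.exp (-w * x)) U :=
    (differentiableOn_laplace (h := fun x : ℝ => f x)
      (hf.continuous.comp Complex.continuous_ofReal).aestronglyMeasurable hint).mono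
      Set.inter_subset_left
  have h2 : DifferentiableOn ℂ (fun w : ℂ => Complex.I *
      ∫ y in Set.Ioi (0:ℝ), f (Complex.I * y) * Complex.exp (-(Complex.I * w) * y)) U := by
    have hfc := hf.continuous
    have hc : Continuous (fun y : ℝ => f (Complex.I * y)) := by fun_prop
    have h3 := differentiableOn_laplace (h := fun y : ℝ => f (Complex.I * y)) (s₀ := a)
      hc.aestronglyMeasurable (fun s hs => integrable_of_norm_le_exp hc (C := C) (a := a)
        (fun x hx => by simpa [abs_of_pos hx] using hb (Complex.I * x)) hs)
    refine (h3.comp (s := U) (f := fun w => Complex.I * w) (by fun_prop) ?_).const_mul Complex.I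
    rintro v ⟨-, hv⟩
    simp only [Set.mem_ofPred_eq, Complex.mul_re, Complex.I_re, Complex.I_im] at hv ⊢
    linarith
  have hlarge : IsOpen ({w : ℂ | 2 * a < w.re} ∩ {w : ℂ | w.im < -(2 * a)}) :=
    (isOpen_lt continuous_const Complex.continuous_re).inter
    (isOpen_lt Complex.continuous_im continuous_const)
  refine (h1.analyticOnNhd hUo).eqOn_of_preconnected_of_eventuallyEq (h2.analyticOnNhd hUo)
    hUc.isPreconnected (z₀ := ⟨3 * a, -(3 * a)⟩) ?_ ?_ ⟨hre, him⟩
  · constructor <;> simp <;> linarith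
  · filter_upwards [hlarge.mem_nhds (x := ⟨3 * a, -(3 * a)⟩)
      (by constructor <;> simp <;> linarith)] with v hv
    exact integral_Ioi_eq_rotated_of_large hf ha hb hv.1 hv.2

theorem integrable_exp_neg_mul_abs {s : ℝ} (hs : 0 < s) :
    Integrable (fun x : ℝ => Real.exp (-s * |x|)) := by
  -- a nonzero Bochner integral certifies integrability
  refine Integrable.of_integral_ne_zero ?_
  rw [integral_comp_abs (f := fun x => Real.exp (-s * x)), integral_exp_mul_Ioi (by linarith)]
  simp [hs.ne']

theorem integrable_mul_exp_neg_abs {g : ℝ → ℂ} (hg : MemLp g 2) {s : ℝ} (hs : 0 < s) :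
    Integrable (fun x : ℝ => g x * Real.exp (-s * |x|)) := by
  have h2 : MemLp (fun x : ℝ => (Real.exp (-s * |x|) : ℂ)) 2 := ?_
  · exact hg.integrable_mul h2
  rw [memLp_two_iff_integrable_sq_norm (by fun_prop)]
  refine (integrable_exp_neg_mul_abs (s := 2 * s) (by linarith)).congr
    (Eventually.of_forall fun x => ?_)
  simp only [Complex.norm_real, Real.norm_eq_abs, sq_abs]
  rw [← Real.exp_nat_mul]; congr 1; push_cast; ring

theorem integrable_mul_exp_neg_Ioi {g : ℝ → ℂ} (hg : MemLp g 2) {s : ℝ} (hs : 0 < s) :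
    Integrable (fun x : ℝ => g x * Real.exp (-s * x)) (volume.restrict (Set.Ioi 0)) := by
  refine (integrable_mul_exp_neg_abs hg hs).restrict.congr ?_
  filter_upwards [ae_restrict_mem measurableSet_Ioi] with x hx
  rw [abs_of_pos hx]

theorem memLp_mul_exp_neg_abs {g : ℝ → ℂ} (hg : MemLp g 2) {s : ℝ} (hs : 0 < s) :
    MemLp (fun x : ℝ => g x * Real.exp (-s * |x|)) 2 := by
  refine hg.of_le (hg.aestronglyMeasurable.mul
    (by fun_prop : Continuous fun x : ℝ => (Real.exp (-s * |x|) : ℂ)).aestronglyMeasurable)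
    (Eventually.of_forall fun x => ?_)
  rw [norm_mul, Complex.norm_real, Real.norm_eq_abs, abs_of_pos (Real.exp_pos _)]
  exact mul_le_of_le_one_right (norm_nonneg _) (Real.exp_le_one_iff.2 (by nlinarith [abs_nonneg x]))

/-- Outside the spectral interval, the regularized Fourier integral of a function of exponential
type can be written as a single integral over the imaginary half-axis: each half-line is rotated to
it, and the two rotated integrals differ only in the sign of the phase `ε y`. -/
theorem fourierInv_mul_exp_neg_abs_eq {f : ℂ → ℂ} (hf : Differentiable ℂ f) {C a : ℝ}
    (ha : 0 < a) (hb : ∀ z, ‖f z‖ ≤ C * Real.exp (a * ‖z‖)) (hL : MemLp (fun x : ℝ => f x) 2)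
    {ξ : ℝ} (hξ : a < 2 * Real.pi * ξ) {ε : ℝ} (hε : 0 < ε) :
    𝓕⁻ (fun x : ℝ => f x * Real.exp (-ε * |x|)) ξ =
      ∫ y in Set.Ioi (0:ℝ), f (Complex.I * y) * Real.exp (-(2 * Real.pi * ξ) * y) *
        (2 * Real.sin (ε * y)) := by
  have hfc := hf.continuous
  have hc : Continuous (fun y : ℝ => f (Complex.I * y)) := by fun_prop
  set w : ℂ := ε - 2 * Real.pi * ξ * Complex.I with hw
  have hwre : w.re = ε := by simp [hw]
  have hwim : w.im = -(2 * Real.pi * ξ) := by simp [hw]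
  have hi := integrable_mul_exp_neg_abs hL hε
  set G : ℝ → ℂ := fun x => Complex.exp (2 * Real.pi * ξ * x * Complex.I) *
    (f x * Real.exp (-ε * |x|)) with hG
  have hGi : Integrable G := by
    refine hi.bdd_mul (c := 1) (by fun_prop) (Eventually.of_forall fun x => ?_)
    simp [Complex.norm_exp]
  have e0 : 𝓕⁻ (fun x : ℝ => f x * Real.exp (-ε * |x|)) ξ = ∫ x, G x := by
    rw [Real.fourierInv_eq']
    refine integral_congr_ae (Eventually.of_forall fun x => ?_)
    simp only [hG, smul_eq_mul]
    congr 2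
    simp; ring
  have e1 : ∫ x, G x = (∫ x in Set.Ioi (0:ℝ), G (-x)) + ∫ x in Set.Ioi (0:ℝ), G x := by
    rw [integral_comp_neg_Ioi, neg_zero,
      ← setIntegral_union (Set.Iic_disjoint_Ioi le_rfl) measurableSet_Ioi hGi.integrableOn
      hGi.integrableOn, Set.Iic_union_Ioi, setIntegral_univ]
  have e2 : ∫ x in Set.Ioi (0:ℝ), G x = Complex.I *
      ∫ y in Set.Ioi (0:ℝ), f (Complex.I * y) * Complex.exp (-(Complex.I * w) * y) := by
    rw [← integral_Ioi_eq_rotated hf ha hb (fun s hs => integrable_mul_exp_neg_Ioi hL hs)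
      (by rw [hwre]; exact hε) (by rw [hwim]; linarith)]
    refine setIntegral_congr_fun measurableSet_Ioi fun x hx => ?_
    simp only [hG]
    rw [abs_of_pos hx, Complex.ofReal_exp, mul_left_comm, ← Complex.exp_add]
    congr 2
    rw [hw]; push_cast; ring
  -- the negative half-line reduces to the positive one for the reflected function
  set g : ℂ → ℂ := fun z => (starRingEnd ℂ) (f (-(starRingEnd ℂ) z)) with hg
  have hgd : Differentiable ℂ g := by
    have h1 : Differentiable ℂ (fun z => f (-z)) := hf.comp differentiable_neg
    have : g = (starRingEnd ℂ) ∘ (fun z => f (-z)) ∘ (starRingEnd ℂ) := rfl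
    rw [this]
    intro z
    exact differentiableAt_conj_conj_iff.2 (h1 _)
  have hgL : MemLp (fun x : ℝ => g x) 2 := by
    have h1 : MemLp (fun x : ℝ => f (-x : ℝ)) 2 :=
      hL.comp_measurePreserving (Measure.measurePreserving_neg volume)
    refine h1.of_le (hgd.continuous.comp Complex.continuous_ofReal).aestronglyMeasurable
      (Eventually.of_forall fun x => ?_)
    simp [hg]
  have e3 : ∫ x in Set.Ioi (0:ℝ), G (-x) = -Complex.I *
      ∫ y in Set.Ioi (0:ℝ), f (Complex.I * y) *
        Complex.exp (Complex.I * (starRingEnd ℂ) w * y) := by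
    have h1 := integral_Ioi_eq_rotated hgd (C := C) ha (fun z => by
      simpa only [hg, RCLike.norm_conj, norm_neg] using hb (-(starRingEnd ℂ) z))
      (fun s hs => integrable_mul_exp_neg_Ioi hgL hs) (w := w)
      (by rw [hwre]; exact hε) (by rw [hwim]; linarith)
    have h2 := congrArg (starRingEnd ℂ) h1
    rw [map_mul, ← integral_conj, ← integral_conj, Complex.conj_I] at h2
    convert h2 using 1
    · refine setIntegral_congr_fun measurableSet_Ioi fun x hx => ?_
      simp only [hG, hg, map_mul, Complex.conj_conj, ← Complex.exp_conj, Complex.conj_ofReal,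
        map_neg]
      rw [abs_neg, abs_of_pos hx, Complex.ofReal_exp, mul_left_comm, ← Complex.exp_add]
      push_cast
      congr 2
      rw [hw]; simp [Complex.conj_ofNat]; ring
    · congr 1
      refine setIntegral_congr_fun measurableSet_Ioi fun x hx => ?_
      simp only [hg, map_mul, Complex.conj_conj, ← Complex.exp_conj, Complex.conj_ofReal,
        map_neg, Complex.conj_I]
      simp
  have hI : ∀ v : ℂ, a < v.re → Integrable (fun y : ℝ => f (Complex.I * y) * Complex.exp (-v * y))
      (volume.restrict (Set.Ioi 0)) := by
    intro v hv
    refine (integrable_of_norm_le_exp hc (C := C) (a := a)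
        (fun x hx => by simpa [abs_of_pos hx] using hb (Complex.I * x)) hv).mono
      (by fun_prop : Continuous fun y : ℝ => f (Complex.I * y) *
        Complex.exp (-v * y)).aestronglyMeasurable (Eventually.of_forall fun x => ?_)
    simp [Complex.norm_exp]
  have hI1 := hI (Complex.I * w) (by simp [hwim]; linarith)
  have hI2 := hI (-(Complex.I * (starRingEnd ℂ) w)) (by simp [hwim]; linarith)
  rw [neg_neg] at hI2
  rw [e0, e1, e2, e3, neg_mul, neg_add_eq_sub, ← mul_sub, ← integral_sub hI1 hI2,
    ← integral_const_mul]
  refine integral_congr_ae (Eventually.of_forall fun y => ?_)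
  simp only
  have x1 : -(Complex.I * w) * y =
      ((-(2 * Real.pi * ξ) * y : ℝ) : ℂ) + -((ε * y : ℝ) : ℂ) * Complex.I := by
    rw [hw]; push_cast; linear_combination (2 * Real.pi * ξ * y : ℂ) * Complex.I_sq
  have x2 : Complex.I * (starRingEnd ℂ) w * y =
      ((-(2 * Real.pi * ξ) * y : ℝ) : ℂ) + ((ε * y : ℝ) : ℂ) * Complex.I := by
    rw [hw]; simp only [map_sub, map_mul, Complex.conj_ofReal, Complex.conj_I, map_ofNat]
    push_cast; linear_combination (2 * Real.pi * ξ * y : ℂ) * Complex.I_sq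
  rw [x1, x2, Complex.exp_add, Complex.exp_add, ← Complex.ofReal_exp, Complex.ofReal_sin,
    Complex.sin]
  ring

theorem tendsto_fourierInv_mul_exp_neg_abs {f : ℂ → ℂ} (hf : Differentiable ℂ f) {C a : ℝ}
    (ha : 0 < a) (hb : ∀ z, ‖f z‖ ≤ C * Real.exp (a * ‖z‖)) (hL : MemLp (fun x : ℝ => f x) 2)
    {ξ : ℝ} (hξ : a < 2 * Real.pi * ξ) :
    Tendsto (fun ε : ℝ => 𝓕⁻ (fun x : ℝ => f x * Real.exp (-ε * |x|)) ξ) (𝓝[>] 0) (𝓝 0) := by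
  have hfc := hf.continuous
  have hc : Continuous (fun y : ℝ => f (Complex.I * y)) := by fun_prop
  have hdom := integrable_of_norm_le_exp hc (C := C) (a := a)
    (fun x hx => by simpa [abs_of_pos hx] using hb (Complex.I * x)) hξ
  have key : Tendsto (fun ε : ℝ => ∫ y in Set.Ioi (0:ℝ), f (Complex.I * y) *
      Real.exp (-(2 * Real.pi * ξ) * y) * (2 * Real.sin (ε * y))) (𝓝[>] 0)
      (𝓝 (∫ y in Set.Ioi (0:ℝ), (0 : ℂ))) := by
    refine tendsto_integral_filter_of_dominated_convergence
      (fun y => 2 * ‖f (Complex.I * y) * Real.exp (-(2 * Real.pi * ξ) * y)‖)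
      (Eventually.of_forall fun ε => (by fun_prop : Continuous fun y : ℝ => f (Complex.I * y) *
        Real.exp (-(2 * Real.pi * ξ) * y) * (2 * Real.sin (ε * y))).aestronglyMeasurable)
      (Eventually.of_forall fun ε => Eventually.of_forall fun y => ?_)
      (hdom.norm.const_mul 2) (Eventually.of_forall fun y => ?_)
    · rw [norm_mul, mul_comm]
      gcongr
      rw [norm_mul, Complex.norm_real, Real.norm_eq_abs, Complex.norm_ofNat]
      linarith [Real.abs_sin_le_one (ε * y)]
    · have hct : Continuous fun ε : ℝ => f (Complex.I * y) *
        Real.exp (-(2 * Real.pi * ξ) * y) * (2 * Real.sin (ε * y)) := by fun_prop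
      simpa using (hct.tendsto 0).mono_left nhdsWithin_le_nhds
  rw [integral_zero] at key
  refine key.congr' ?_
  filter_upwards [self_mem_nhdsWithin] with ε hε
  exact (fourierInv_mul_exp_neg_abs_eq hf ha hb hL hξ hε).symm

theorem norm_toLp_sq {α : Type*} [MeasurableSpace α] {μ : Measure α} {g : α → ℂ}
    (hg : MemLp g 2 μ) : ‖hg.toLp g‖ ^ 2 = ∫ x, ‖g x‖ ^ 2 ∂μ := by
  have h := inner_self_eq_norm_sq_to_K (𝕜 := ℂ) (hg.toLp g)
  rw [L2.inner_def] at h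
  apply Complex.ofReal_injective
  push_cast
  rw [← integral_complex_ofReal]
  refine h.symm.trans (integral_congr_ae ?_)
  filter_upwards [hg.coeFn_toLp] with x hx
  rw [hx, inner_self_eq_norm_sq_to_K]
  simp

/-- The regularizations `g(x) e^{-ε|x|}` converge to `g` in `L²`. -/
theorem tendsto_mul_exp_neg_abs_toLp {g : ℝ → ℂ} (hg : MemLp g 2) {ε : ℕ → ℝ}
    (hε : ∀ n, 0 < ε n) (hε0 : Tendsto ε atTop (𝓝 0)) :
    Tendsto (fun n => (memLp_mul_exp_neg_abs hg (hε n)).toLp _) atTop (𝓝 (hg.toLp g)) := by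
  rw [tendsto_iff_norm_sub_tendsto_zero]
  have hsq : Tendsto (fun n => ∫ x, ‖g x * Real.exp (-ε n * |x|) - g x‖ ^ 2) atTop
      (𝓝 (∫ _ : ℝ, (0 : ℝ))) := by
    refine tendsto_integral_of_dominated_convergence (fun x => ‖g x‖ ^ 2)
      (fun n => ((memLp_mul_exp_neg_abs hg (hε n)).sub hg).aestronglyMeasurable.norm.pow 2)
      ((memLp_two_iff_integrable_sq_norm hg.aestronglyMeasurable).1 hg)
      (fun n => Eventually.of_forall fun x => ?_) (Eventually.of_forall fun x => ?_)
    · have h1 : Real.exp (-ε n * |x|) ≤ 1 :=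
        Real.exp_le_one_iff.2 (by nlinarith [abs_nonneg x, hε n])
      have h2 : ‖g x * Real.exp (-ε n * |x|) - g x‖ ≤ ‖g x‖ := by
        rw [← mul_sub_one, norm_mul, ← Complex.ofReal_one, ← Complex.ofReal_sub, Complex.norm_real]
        refine mul_le_of_le_one_right (norm_nonneg _) ?_
        rw [Real.norm_eq_abs, abs_le]
        constructor <;> linarith [Real.exp_pos (-ε n * |x|)]
      rw [Real.norm_eq_abs, abs_of_nonneg (by positivity)]
      gcongr
    · have hct : Continuous fun e : ℝ => ‖g x * Real.exp (-e * |x|) - g x‖ ^ 2 := by fun_prop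
      simpa [Function.comp_def] using (hct.tendsto 0).comp hε0
  rw [integral_zero] at hsq
  have hs := hsq.sqrt
  rw [Real.sqrt_zero] at hs
  refine hs.congr fun n => ?_
  rw [← MemLp.toLp_sub, Real.sqrt_eq_iff_mul_self_eq (by positivity) (norm_nonneg _), ← sq,
    norm_toLp_sq]
  rfl

/-- **Paley–Wiener theorem**: an entire function of exponential type at most `τ` which is square
integrable on the line has its spectrum in `2π|ξ| ≤ τ`. -/
theorem fourierInv_toLp_eq_zero {τ : ℝ} (hτ : 0 ≤ τ) {f : ℂ → ℂ} (hf : Differentiable ℂ f)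
    (hexp : HasExpTypeLE τ f) (hL : MemLp (fun x : ℝ => f x) 2) :
    ∀ᵐ ξ : ℝ, τ < 2 * Real.pi * |ξ| →
      ((𝓕⁻ (hL.toLp _) : Lp ℂ 2 (volume : Measure ℝ)) : ℝ → ℂ) ξ = 0 := by
  have hpt : ∀ {f : ℂ → ℂ} (_ : Differentiable ℂ f) (_ : HasExpTypeLE τ f)
      (_ : MemLp (fun x : ℝ => f x) 2) {ξ : ℝ} (_ : τ < 2 * Real.pi * ξ),
      Tendsto (fun ε : ℝ => 𝓕⁻ (fun x : ℝ => f x * Real.exp (-ε * |x|)) ξ) (𝓝[>] 0) (𝓝 0) := by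
    intro f hf hexp hL ξ hξ
    obtain ⟨C, hC⟩ := hexp ((2 * Real.pi * ξ - τ) / 2) (by linarith)
    exact tendsto_fourierInv_mul_exp_neg_abs hf (by linarith) hC hL (by linarith)
  have hpt' : ∀ ξ : ℝ, τ < 2 * Real.pi * |ξ| →
      Tendsto (fun ε : ℝ => 𝓕⁻ (fun x : ℝ => f x * Real.exp (-ε * |x|)) ξ) (𝓝[>] 0) (𝓝 0) := by
    intro ξ hξ
    rcases le_total 0 ξ with h | h
    · exact hpt hf hexp hL (by rwa [abs_of_nonneg h] at hξ)
    · rw [abs_of_nonpos h] at hξ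
      have := hpt (f := fun z => f (-z)) (hf.comp differentiable_neg)
        (fun ε hε => (hexp ε hε).imp fun C hC z => by simpa using hC (-z))
        (by simpa [Function.comp_def] using
          hL.comp_measurePreserving (Measure.measurePreserving_neg volume)) hξ
      -- reflection `f(-z)` exchanges `ξ` and `-ξ`
      refine this.congr fun ε => ?_
      rw [Real.fourierInv_eq_fourier_comp_neg, ← Real.fourierInv_eq_fourier_neg]
      simp
  set ε : ℕ → ℝ := fun n => 1 / ((n : ℝ) + 1) with hε
  have hεp : ∀ n, 0 < ε n := fun n => by positivity
  have hε0 : Tendsto ε atTop (𝓝 0) := tendsto_one_div_add_atTop_nhds_zero_nat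
  have ht := ((Lp.fourierTransformₗᵢ ℝ ℂ).symm.continuous.tendsto _).comp
    (tendsto_mul_exp_neg_abs_toLp hL hεp hε0)
  obtain ⟨φ, hφ, hae⟩ := (tendstoInMeasure_of_tendsto_Lp ht).exists_seq_tendsto_ae
  have hall : ∀ᵐ ξ : ℝ, ∀ n, ((𝓕⁻ ((memLp_mul_exp_neg_abs hL (hεp n)).toLp _) :
      Lp ℂ 2 (volume : Measure ℝ)) : ℝ → ℂ) ξ =
      𝓕⁻ (fun x : ℝ => f x * Real.exp (-ε n * |x|)) ξ :=
    ae_all_iff.2 fun n => fourierInv_toLp_ae_eq (integrable_mul_exp_neg_abs hL (hεp n))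
      (memLp_mul_exp_neg_abs hL (hεp n))
  filter_upwards [hae, hall] with ξ h1 h2 hξ
  refine tendsto_nhds_unique h1 ?_
  have h3 := (hpt' ξ hξ).comp (tendsto_nhdsWithin_iff.2
    ⟨hε0.comp hφ.tendsto_atTop, Eventually.of_forall fun n => hεp (φ n)⟩)
  exact h3.congr fun n => (h2 (φ n)).symm

/-! ### Positivity of the weight -/

theorem le_arccos_599_div_1000 : (87 / 100 : ℝ) ≤ Real.arccos (599 / 1000) := by
  have h1 : (599 / 1000 : ℝ) ≤ Real.cos (87 / 100) := by
    have := Real.one_sub_sq_div_two_le_cos (x := 87 / 100)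
    norm_num at this ⊢
    linarith
  have h2 := Real.arccos_le_arccos h1
  rwa [Real.arccos_cos (by norm_num) (by linarith [Real.pi_gt_three])] at h2

/-- Here `g(u) = u sin u + cos u - 1 + 0.2995 u²` has `g'(u) = u (cos u + 0.599)`, so on `[0, 2π]` its
minimum is at `0` or at `π + arccos 0.599`. -/
theorem mul_sin_add_cos_ge_of_nonneg {u : ℝ} (hu : 0 ≤ u) :
    -(599 / 2000 * u ^ 2) ≤ u * Real.sin u + Real.cos u - 1 := by
  set g : ℝ → ℝ := fun u => u * Real.sin u + Real.cos u - 1 + 599 / 2000 * u ^ 2 with hg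
  suffices h : 0 ≤ g u by simp only [hg] at h; linarith
  -- beyond `6 < 2π` the quadratic term alone dominates `u + 2`
  rcases le_total 6 u with h6 | h6
  · simp only [hg]
    nlinarith [Real.neg_one_le_sin u, Real.neg_one_le_cos u]
  have hpi := Real.pi_gt_d2
  have hpi' := Real.pi_lt_d2
  set t := Real.arccos (599 / 1000) with ht
  have ht1 : 87 / 100 ≤ t := le_arccos_599_div_1000
  have ht2 : t ≤ Real.pi / 2 := Real.arccos_le_pi_div_two.2 (by norm_num)
  have hct : Real.cos t = 599 / 1000 := Real.cos_arccos (by norm_num) (by norm_num)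
  have hd : ∀ v, HasDerivAt g (v * (Real.cos v + 599 / 1000)) v := by
    intro v
    have := ((((hasDerivAt_id v).mul (Real.hasDerivAt_sin v)).add
      (Real.hasDerivAt_cos v)).sub_const 1).add ((hasDerivAt_pow 2 v).const_mul (599 / 2000 : ℝ))
    refine this.congr_deriv ?_
    simp; ring
  have hgc : Continuous g := by fun_prop
  have hmono : ∀ a b : ℝ, (∀ v ∈ Set.Ioo a b, 0 ≤ v * (Real.cos v + 599 / 1000)) →
      MonotoneOn g (Set.Icc a b) := fun a b h =>
    monotoneOn_of_deriv_nonneg (convex_Icc a b) hgc.continuousOn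
      (fun v _ => (hd v).differentiableAt.differentiableWithinAt)
      fun v hv => by rw [(hd v).deriv]; rw [interior_Icc] at hv; exact h v hv
  have hanti : ∀ a b : ℝ, (∀ v ∈ Set.Ioo a b, v * (Real.cos v + 599 / 1000) ≤ 0) →
      AntitoneOn g (Set.Icc a b) := fun a b h =>
    antitoneOn_of_deriv_nonpos (convex_Icc a b) hgc.continuousOn
      (fun v _ => (hd v).differentiableAt.differentiableWithinAt)
      fun v hv => by rw [(hd v).deriv]; rw [interior_Icc] at hv; exact h v hv
  have hcosm : ∀ v, Real.cos v = -Real.cos (v - Real.pi) := fun v => by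
    rw [Real.cos_sub_pi]; ring
  have hmin : 0 ≤ g (Real.pi + t) := by
    have hs : Real.sin t ≤ 801 / 1000 := by
      nlinarith [Real.sin_sq_add_cos_sq t]
    simp only [hg]
    rw [add_comm Real.pi t, Real.sin_add_pi, Real.cos_add_pi, hct]
    have h4 : 401 / 100 ≤ t + Real.pi := by linarith
    nlinarith
  rcases le_total u (Real.pi - t) with h1 | h1
  · have := hmono 0 (Real.pi - t) (fun v hv => mul_nonneg hv.1.le (by
      have := Real.cos_le_cos_of_nonneg_of_le_pi hv.1.le (by linarith) hv.2.le
      rw [Real.cos_pi_sub] at this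
      linarith)) ⟨le_rfl, by linarith⟩ ⟨hu, h1⟩ hu
    have h0 : g 0 = 0 := by simp [hg]
    linarith
  rcases le_total u (Real.pi + t) with h2 | h2
  · refine hmin.trans (hanti (Real.pi - t) (Real.pi + t) (fun v hv => ?_) ⟨h1, h2⟩
      ⟨by linarith, le_rfl⟩ h2)
    refine mul_nonpos_of_nonneg_of_nonpos (by linarith [hv.1]) ?_
    have := Real.cos_le_cos_of_nonneg_of_le_pi (x := |v - Real.pi|) (y := t) (abs_nonneg _)
      (by linarith) (abs_le.2 ⟨by linarith [hv.1], by linarith [hv.2]⟩)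
    rw [Real.cos_abs] at this
    rw [hcosm]; linarith
  · refine hmin.trans (hmono (Real.pi + t) (2 * Real.pi) (fun v hv => ?_)
      ⟨le_rfl, by linarith⟩ ⟨h2, by linarith⟩ h2)
    refine mul_nonneg (by linarith [hv.1]) ?_
    have := Real.cos_le_cos_of_nonneg_of_le_pi (x := t) (y := v - Real.pi) (by linarith)
      (by linarith [hv.2]) (by linarith [hv.1])
    rw [hcosm]; linarith

theorem mul_sin_add_cos_ge (u : ℝ) :
    -(599 / 2000 * u ^ 2) ≤ u * Real.sin u + Real.cos u - 1 := by
  rcases le_total 0 u with h | h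
  · exact mul_sin_add_cos_ge_of_nonneg h
  · simpa using mul_sin_add_cos_ge_of_nonneg (neg_nonneg.2 h)

/-- A lower bound for `∫₀ˢ a cos(ωa) da` persists when the decreasing weight `e^{-ca}` is inserted. -/
theorem integral_mul_exp_mul_cos_ge_of_primitive {κ c ω : ℝ} (hκ : 0 ≤ κ) (hc : 0 ≤ c) {M : ℝ → ℝ}
    (hM0 : M 0 = 0) (hM : ∀ s, HasDerivAt M (s * Real.cos (ω * s)) s)
    (hMκ : ∀ s, -(κ * s ^ 2) ≤ M s) {s : ℝ} (hs : 0 ≤ s) :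
    -(κ * s ^ 2) ≤ ∫ a in (0:ℝ)..s, a * Real.exp (-c * a) * Real.cos (ω * a) := by
  -- `D` vanishes at `0`, and its derivative is `c (M + κ s²) e^{-cs} + 2 κ s (1 - e^{-cs}) ≥ 0`
  set D : ℝ → ℝ := fun s => (∫ a in (0:ℝ)..s, a * Real.exp (-c * a) * Real.cos (ω * a)) -
    (M s + κ * s ^ 2) * Real.exp (-c * s) + κ * s ^ 2 with hD
  have hd : ∀ v, HasDerivAt D (c * (M v + κ * v ^ 2) * Real.exp (-c * v) +
      2 * κ * v * (1 - Real.exp (-c * v))) v := by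
    intro v
    have h1 : HasDerivAt (fun s => ∫ a in (0:ℝ)..s, a * Real.exp (-c * a) * Real.cos (ω * a))
        (v * Real.exp (-c * v) * Real.cos (ω * v)) v :=
      ((by fun_prop : Continuous fun a : ℝ =>
        a * Real.exp (-c * a) * Real.cos (ω * a)).integral_hasStrictDerivAt 0 v).hasDerivAt
    have h2 : HasDerivAt (fun s => κ * s ^ 2) (κ * (2 * v)) v := by
      simpa using (hasDerivAt_pow 2 v).const_mul κ
    have h3 : HasDerivAt (fun s => Real.exp (-c * s)) (Real.exp (-c * v) * (-c)) v := by
      simpa using ((hasDerivAt_id v).const_mul (-c)).exp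
    refine ((h1.sub (((hM v).add h2).mul h3)).add h2).congr_deriv ?_
    simp only [Pi.add_apply]
    ring
  have hmono : MonotoneOn D (Set.Icc 0 s) :=
    monotoneOn_of_deriv_nonneg (convex_Icc _ _)
      (fun v _ => (hd v).continuousAt.continuousWithinAt)
      (fun v _ => (hd v).differentiableAt.differentiableWithinAt) fun v hv => by
        rw [(hd v).deriv]
        rw [interior_Icc] at hv
        have h1 : Real.exp (-c * v) ≤ 1 := Real.exp_le_one_iff.2 (by nlinarith [hv.1])
        have h2 : 0 ≤ M v + κ * v ^ 2 := by linarith [hMκ v]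
        have h3 := hv.1.le
        have h4 := sub_nonneg.2 h1
        positivity
  have h0 := hmono ⟨le_rfl, hs⟩ ⟨hs, le_rfl⟩ hs
  have hD0 : D 0 = 0 := by simp [hD, hM0]
  have h1 : 0 ≤ (M s + κ * s ^ 2) * Real.exp (-c * s) :=
    mul_nonneg (by linarith [hMκ s]) (Real.exp_pos _).le
  rw [hD0] at h0
  simp only [hD] at h0
  linarith

theorem integral_mul_exp_mul_cos_ge {c : ℝ} (hc : 0 ≤ c) (ω : ℝ) {s : ℝ} (hs : 0 ≤ s) :
    -(599 / 2000 * s ^ 2) ≤ ∫ a in (0:ℝ)..s, a * Real.exp (-c * a) * Real.cos (ω * a) := by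
  rcases eq_or_ne ω 0 with rfl | hω
  · refine integral_mul_exp_mul_cos_ge_of_primitive (M := fun s => s ^ 2 / 2) (by norm_num) hc
      (by simp) (fun s => ?_) (fun s => by nlinarith [sq_nonneg s]) hs
    refine ((hasDerivAt_pow 2 s).div_const 2).congr_deriv ?_
    simp
  · refine integral_mul_exp_mul_cos_ge_of_primitive
      (M := fun s => (ω * s * Real.sin (ω * s) + Real.cos (ω * s) - 1) / ω ^ 2) (by norm_num) hc
      (by simp) (fun s => ?_) (fun s => ?_) hs
    · have h0 : HasDerivAt (fun s => ω * s) ω s := by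
        simpa using (hasDerivAt_id s).const_mul ω
      refine ((((h0.mul h0.sin).add h0.cos).sub_const 1).div_const (ω ^ 2)).congr_deriv ?_
      field_simp
      ring
    · rw [le_div_iff₀ (by positivity)]
      have := mul_sin_add_cos_ge (ω * s)
      nlinarith

/-- The function `α ↦ |α| e^{-c|α|}`. -/
def absExpKernel (c : ℝ) (α : ℝ) : ℝ := |α| * Real.exp (-c * |α|)

theorem continuous_absExpKernel (c : ℝ) : Continuous (absExpKernel c) := by
  unfold absExpKernel; fun_prop

theorem absExpKernel_neg (c α : ℝ) : absExpKernel c (-α) = absExpKernel c α := by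
  simp [absExpKernel]

theorem absExpKernel_nonneg (c α : ℝ) : 0 ≤ absExpKernel c α :=
  mul_nonneg (abs_nonneg _) (Real.exp_pos _).le

theorem nuHat_eq_setIntegral {Δ c₁ c₂ c₃ : ℝ} (hc₁ : 0 < c₁) (hc₂ : 0 < c₂) (x : ℝ) :
    nuHat (nuMeasure Δ c₁ c₂ c₃) x = c₁ + c₂ * ∫ α in Set.Icc (-Δ) Δ,
      Complex.exp (-2 * Real.pi * Complex.I * x * α) * absExpKernel c₃ α := by
  have hd : (fun α : ℝ => ENNReal.ofReal (c₂ * |α| * Real.exp (-c₃ * |α|))) =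
      fun α => ENNReal.ofReal (c₂ * absExpKernel c₃ α) := by
    funext α; rw [absExpKernel, mul_assoc]
  have hm : Measurable fun α => ENNReal.ofReal (c₂ * absExpKernel c₃ α) :=
    ((continuous_absExpKernel c₃).const_mul c₂).measurable.ennreal_ofReal
  have hcc := continuous_absExpKernel c₃
  have hsm : ∀ α : ℝ, (ENNReal.ofReal (c₂ * absExpKernel c₃ α)).toReal •
      Complex.exp (-2 * Real.pi * Complex.I * x * α) =
      c₂ * (Complex.exp (-2 * Real.pi * Complex.I * x * α) * absExpKernel c₃ α) := fun α => by
    rw [ENNReal.toReal_ofReal (mul_nonneg hc₂.le (absExpKernel_nonneg _ _)), Complex.real_smul]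
    push_cast; ring
  have hcont : Continuous fun α : ℝ =>
      (c₂ : ℂ) * (Complex.exp (-2 * Real.pi * Complex.I * x * α) * absExpKernel c₃ α) := by fun_prop
  rw [nuHat, nuMeasure, hd, integral_add_measure, integral_smul_measure, integral_dirac,
    integral_withDensity_eq_integral_toReal_smul hm (by simp)]
  · simp_rw [hsm]
    rw [integral_const_mul]
    simp [hc₁.le]
  · exact (integrable_dirac (by simp)).smul_measure (by simp)
  · rw [integrable_withDensity_iff_integrable_smul' hm (by simp)]
    simp_rw [hsm]
    exact hcont.continuousOn.integrableOn_compact isCompact_Icc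

/-- The Fourier transform of the measure, as a real number: by symmetry only the cosine integral
over `[0, Δ]` remains. -/
def nuHatReal (Δ c₁ c₂ c₃ : ℝ) (x : ℝ) : ℝ :=
  c₁ + 2 * c₂ * ∫ a in (0:ℝ)..Δ, a * Real.exp (-c₃ * a) * Real.cos (2 * Real.pi * x * a)

theorem nuHat_eq_ofReal {Δ c₁ c₂ c₃ : ℝ} (hΔ : 0 ≤ Δ) (hc₁ : 0 < c₁) (hc₂ : 0 < c₂) (x : ℝ) :
    nuHat (nuMeasure Δ c₁ c₂ c₃) x = nuHatReal Δ c₁ c₂ c₃ x := by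
  have hcc := continuous_absExpKernel c₃
  set F : ℝ → ℂ :=
    fun α => Complex.exp (-2 * Real.pi * Complex.I * x * α) * absExpKernel c₃ α with hF
  have hFc : Continuous F := by fun_prop
  have hi := fun a b => hFc.intervalIntegrable (μ := volume) a b
  rw [nuHat_eq_setIntegral hc₁ hc₂, nuHatReal, integral_Icc_eq_integral_Ioc,
    ← intervalIntegral.integral_of_le (by linarith),
    ← intervalIntegral.integral_add_adjacent_intervals (hi (-Δ) 0) (hi 0 Δ)]
  have h1 : ∫ α in (-Δ)..0, F α = ∫ α in (0:ℝ)..Δ, F (-α) := by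
    rw [intervalIntegral.integral_comp_neg, neg_zero]
  rw [h1, ← intervalIntegral.integral_add
    ((by fun_prop : Continuous fun α => F (-α)).intervalIntegrable _ _) (hi 0 Δ)]
  push_cast
  rw [← intervalIntegral.integral_ofReal]
  have h2 : ∫ α in (0:ℝ)..Δ, F (-α) + F α =
      ∫ α in (0:ℝ)..Δ, 2 * ((α * Real.exp (-c₃ * α) * Real.cos (2 * Real.pi * x * α) : ℝ) : ℂ) := by
    refine intervalIntegral.integral_congr fun α hα => ?_
    rw [Set.uIcc_of_le hΔ] at hα
    simp only [hF, absExpKernel_neg]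
    rw [absExpKernel, abs_of_nonneg hα.1]
    push_cast
    rw [Complex.cos]
    ring_nf
  rw [h2, intervalIntegral.integral_const_mul]
  push_cast
  ring

/-- The weight is bounded away from zero. The constant `1/1000` is
below `1 - 2 · (5/3) · (599/2000) = 1/600`. -/
theorem le_nuHatReal {Δ c₁ c₂ c₃ : ℝ} (hΔ : 0 ≤ Δ) (hc₁ : 0 < c₁) (hc₂ : 0 < c₂) (hc₃ : 0 ≤ c₃)
    (hbound : c₂ / c₁ * Δ ^ 2 ≤ 5 / 3) (x : ℝ) : c₁ / 1000 ≤ nuHatReal Δ c₁ c₂ c₃ x := by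
  have h := integral_mul_exp_mul_cos_ge hc₃ (2 * Real.pi * x) hΔ
  rw [div_mul_eq_mul_div, div_le_iff₀ hc₁] at hbound
  unfold nuHatReal
  nlinarith

theorem nuHatReal_le {Δ c₁ c₂ c₃ : ℝ} (hΔ : 0 ≤ Δ) (hc₂ : 0 < c₂) (hc₃ : 0 ≤ c₃)
    (x : ℝ) : nuHatReal Δ c₁ c₂ c₃ x ≤ c₁ + 2 * c₂ * (Δ * Δ) := by
  have := intervalIntegral.norm_integral_le_of_norm_le_const (a := 0) (b := Δ)
    (f := fun a => a * Real.exp (-c₃ * a) * Real.cos (2 * Real.pi * x * a)) (C := Δ) fun a ha => by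
      rw [Set.uIoc_of_le hΔ] at ha
      rw [Real.norm_eq_abs, abs_mul, abs_mul, abs_of_pos ha.1, Real.abs_exp]
      have h1 : Real.exp (-c₃ * a) ≤ 1 := Real.exp_le_one_iff.2 (by nlinarith [ha.1])
      calc _ ≤ Δ * 1 * 1 := by
            gcongr
            · exact ha.2
            · exact Real.abs_cos_le_one _
        _ = Δ := by ring
  rw [Real.norm_eq_abs, sub_zero, abs_of_nonneg hΔ] at this
  have h2 := (abs_le.1 this).2
  unfold nuHatReal
  gcongr

theorem continuous_nuHatReal (Δ c₁ c₂ c₃ : ℝ) : Continuous (nuHatReal Δ c₁ c₂ c₃) := by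
  unfold nuHatReal
  have : Continuous fun x : ℝ =>
      ∫ a in (0:ℝ)..Δ, a * Real.exp (-c₃ * a) * Real.cos (2 * Real.pi * x * a) :=
    intervalIntegral.continuous_parametric_intervalIntegral_of_continuous' (by fun_prop) _ _
  fun_prop

/-! ### The space as a space of Fourier transforms, and its kernel -/

/-- The entire function `z ↦ ∫_{-h}^{h} e^{-2πizα} ψ(α) dα`; on the real line it is the Fourier
transform of `ψ` extended by zero. -/
def pwTransform (h : ℝ) (ψ : ℝ → ℂ) (z : ℂ) : ℂ :=
  ∫ α in Set.Icc (-h) h, Complex.exp (-2 * Real.pi * Complex.I * z * α) * ψ α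

theorem norm_cexp_le_of_mem_Icc {h α : ℝ} (hα : α ∈ Set.Icc (-h) h) (z : ℂ) :
    ‖Complex.exp (-2 * Real.pi * Complex.I * z * α)‖ ≤ Real.exp (2 * Real.pi * h * ‖z‖) := by
  rw [Complex.norm_exp]
  refine Real.exp_le_exp.2 ((Complex.re_le_norm _).trans ?_)
  have : |α| ≤ h := abs_le.2 hα
  simp only [norm_mul, norm_neg, Complex.norm_ofNat, Complex.norm_real, Complex.norm_I,
    Real.norm_eq_abs, abs_of_pos Real.pi_pos, mul_one]
  have h1 : 2 * Real.pi * ‖z‖ * |α| ≤ 2 * Real.pi * ‖z‖ * h := by gcongr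
  linarith

theorem integrable_cexp_mul {h : ℝ} {ψ : ℝ → ℂ} (hψ : IntegrableOn ψ (Set.Icc (-h) h)) (z : ℂ) :
    IntegrableOn (fun α : ℝ => Complex.exp (-2 * Real.pi * Complex.I * z * α) * ψ α)
      (Set.Icc (-h) h) := by
  refine Integrable.bdd_mul (c := Real.exp (2 * Real.pi * h * ‖z‖)) hψ (by fun_prop) ?_
  filter_upwards [ae_restrict_mem measurableSet_Icc] with α hα
  exact norm_cexp_le_of_mem_Icc hα z

theorem differentiable_pwTransform {h : ℝ} (hh : 0 ≤ h) {ψ : ℝ → ℂ}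
    (hψ : IntegrableOn ψ (Set.Icc (-h) h)) : Differentiable ℂ (pwTransform h ψ) := by
  intro z₀
  have key := hasDerivAt_integral_of_dominated_loc_of_deriv_le
    (μ := volume.restrict (Set.Icc (-h) h))
    (F := fun (z : ℂ) (α : ℝ) => Complex.exp (-2 * Real.pi * Complex.I * z * α) * ψ α)
    (F' := fun (z : ℂ) (α : ℝ) => (Complex.exp (-2 * Real.pi * Complex.I * z * α) *
      (-2 * Real.pi * Complex.I * α)) * ψ α) (x₀ := z₀)
    (bound := fun α => (Real.exp (2 * Real.pi * h * (‖z₀‖ + 1)) * (2 * Real.pi * h)) * ‖ψ α‖)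
    (Metric.ball_mem_nhds z₀ one_pos)
    (Eventually.of_forall fun z => (integrable_cexp_mul hψ z).aestronglyMeasurable)
    (integrable_cexp_mul hψ z₀) ?_ ?_ (hψ.norm.const_mul _) ?_
  · exact key.2.differentiableAt
  · exact AEStronglyMeasurable.mul (by fun_prop) hψ.aestronglyMeasurable
  · filter_upwards [ae_restrict_mem measurableSet_Icc] with α hα z hz
    have hz' : ‖z‖ ≤ ‖z₀‖ + 1 := by
      have := norm_le_norm_add_norm_sub z₀ z
      rw [Metric.mem_ball, dist_eq_norm, norm_sub_rev] at hz
      linarith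
    rw [norm_mul, norm_mul]
    gcongr
    · exact (norm_cexp_le_of_mem_Icc hα z).trans (by gcongr)
    · have : |α| ≤ h := abs_le.2 hα
      simp only [norm_mul, norm_neg, Complex.norm_ofNat, Complex.norm_real, Complex.norm_I,
        Real.norm_eq_abs, abs_of_pos Real.pi_pos, mul_one]
      gcongr
  · refine Eventually.of_forall fun α z _ => ?_
    have h1 : HasDerivAt (fun z : ℂ => -2 * Real.pi * Complex.I * z * (α : ℂ))
        (-2 * Real.pi * Complex.I * α) z := by
      simpa using ((hasDerivAt_id z).const_mul (-2 * Real.pi * Complex.I : ℂ)).mul_const (α : ℂ)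
    exact h1.cexp.mul_const _

theorem hasExpTypeLE_pwTransform {h : ℝ} {ψ : ℝ → ℂ}
    (hψ : IntegrableOn ψ (Set.Icc (-h) h)) : HasExpTypeLE (2 * Real.pi * h) (pwTransform h ψ) := by
  intro ε hε
  refine ⟨∫ α in Set.Icc (-h) h, ‖ψ α‖, fun z => ?_⟩
  calc ‖pwTransform h ψ z‖ ≤ ∫ α in Set.Icc (-h) h, Real.exp (2 * Real.pi * h * ‖z‖) * ‖ψ α‖ := by
        refine norm_integral_le_of_norm_le (hψ.norm.const_mul _) ?_
        filter_upwards [ae_restrict_mem measurableSet_Icc] with α hα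
        rw [norm_mul]
        gcongr
        exact norm_cexp_le_of_mem_Icc hα z
    _ = (∫ α in Set.Icc (-h) h, ‖ψ α‖) * Real.exp (2 * Real.pi * h * ‖z‖) := by
        rw [integral_const_mul, mul_comm]
    _ ≤ _ := by
        have : 0 ≤ ∫ α in Set.Icc (-h) h, ‖ψ α‖ := integral_nonneg fun _ => norm_nonneg _
        gcongr
        linarith

theorem pwTransform_ofReal (h : ℝ) (ψ : ℝ → ℂ) (x : ℝ) :
    pwTransform h ψ x = 𝓕 ((Set.Icc (-h) h).indicator ψ) x := by
  rw [Real.fourier_real_eq_integral_exp_smul, pwTransform, ← integral_indicator measurableSet_Icc]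
  refine integral_congr_ae (Eventually.of_forall fun α => ?_)
  by_cases hα : α ∈ Set.Icc (-h) h
  · simp only [Set.indicator_of_mem hα, smul_eq_mul]
    congr 2
    push_cast; ring
  · simp [Set.indicator_of_notMem hα]

/-- The Hilbert space `L²[-h, h]`. -/
abbrev L2Icc (h : ℝ) : Type := Lp ℂ 2 (volume.restrict (Set.Icc (-h) h) : Measure ℝ)

/-- The Hilbert space `L²(ℝ)`. -/
abbrev L2Line : Type := Lp ℂ 2 (volume : Measure ℝ)

/-- Extension by zero `L²[-h, h] → L²(ℝ)`, defined as the adjoint of restriction; see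
`extendZero_apply`. -/
def extendZero (h : ℝ) : L2Icc h →L[ℂ] L2Line :=
  ContinuousLinearMap.adjoint (LpToLpRestrictCLM ℝ ℂ ℂ volume 2 (Set.Icc (-h) h))

theorem memLp_indicator {h : ℝ} {ψ : ℝ → ℂ} (hψ : MemLp ψ 2 (volume.restrict (Set.Icc (-h) h))) :
    MemLp ((Set.Icc (-h) h).indicator ψ) 2 :=
  (memLp_indicator_iff_restrict measurableSet_Icc).2 hψ

theorem extendZero_apply {h : ℝ} {ψ : ℝ → ℂ}
    (hψ : MemLp ψ 2 (volume.restrict (Set.Icc (-h) h))) :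
    extendZero h (hψ.toLp ψ) = (memLp_indicator hψ).toLp _ := by
  refine ext_inner_right ℂ fun g => ?_
  rw [extendZero, ContinuousLinearMap.adjoint_inner_left, L2.inner_def, L2.inner_def]
  have h1 : ∀ᵐ x, ⟪(memLp_indicator hψ).toLp _ x, g x⟫_ℂ =
      (Set.Icc (-h) h).indicator (fun x => ⟪ψ x, g x⟫_ℂ) x := by
    filter_upwards [(memLp_indicator hψ).coeFn_toLp] with x hx
    rw [hx]
    by_cases hxI : x ∈ Set.Icc (-h) h
    · simp only [Set.indicator_of_mem hxI]
    · simp only [Set.indicator_of_notMem hxI, inner_zero_left]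
  rw [integral_congr_ae h1, integral_indicator measurableSet_Icc]
  refine integral_congr_ae ?_
  filter_upwards [hψ.coeFn_toLp, LpToLpRestrictCLM_coeFn ℂ (Set.Icc (-h) h) g] with x h2 h3
  rw [h2, h3]

theorem norm_extendZero {h : ℝ} (ψ : L2Icc h) : ‖extendZero h ψ‖ = ‖ψ‖ := by
  have h0 := Lp.memLp ψ
  have h1 : ψ = h0.toLp ψ := (Lp.toLp_coeFn ψ h0).symm
  have h2 : ‖extendZero h ψ‖ ^ 2 = ‖ψ‖ ^ 2 := by
    rw [h1, extendZero_apply h0, norm_toLp_sq, norm_toLp_sq, ← integral_indicator measurableSet_Icc]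
    refine integral_congr_ae (Eventually.of_forall fun x => ?_)
    by_cases hx : x ∈ Set.Icc (-h) h
    · simp [Set.indicator_of_mem hx]
    · simp [Set.indicator_of_notMem hx]
  exact (sq_eq_sq₀ (norm_nonneg _) (norm_nonneg _)).1 h2

theorem integrable_indicator_of_memLp {h : ℝ} {ψ : ℝ → ℂ}
    (hψ : MemLp ψ 2 (volume.restrict (Set.Icc (-h) h))) :
    Integrable ((Set.Icc (-h) h).indicator ψ) :=
  (integrable_indicator_iff measurableSet_Icc).2 (hψ.integrable (by norm_num))

theorem fourier_extendZero_ae_eq {h : ℝ} {ψ : ℝ → ℂ}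
    (hψ : MemLp ψ 2 (volume.restrict (Set.Icc (-h) h))) :
    (𝓕 (extendZero h (hψ.toLp ψ)) : L2Line) =ᵐ[volume] fun x : ℝ => pwTransform h ψ x := by
  rw [extendZero_apply]
  refine (fourier_toLp_ae_eq (integrable_indicator_of_memLp hψ) _).trans
    (Eventually.of_forall fun x => ?_)
  exact (pwTransform_ofReal h ψ x).symm

theorem memLp_pwTransform {h : ℝ} {ψ : ℝ → ℂ}
    (hψ : MemLp ψ 2 (volume.restrict (Set.Icc (-h) h))) :
    MemLp (fun x : ℝ => pwTransform h ψ x) 2 :=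
  (Lp.memLp _).ae_eq (fourier_extendZero_ae_eq hψ)

theorem pwTransform_congr_ae {h : ℝ} {ψ φ : ℝ → ℂ}
    (hψ : ψ =ᵐ[volume.restrict (Set.Icc (-h) h)] φ) : pwTransform h ψ = pwTransform h φ := by
  funext z
  refine integral_congr_ae ?_
  filter_upwards [hψ] with x hx
  rw [hx]

theorem eq_of_eq_ofReal {f g : ℂ → ℂ} (hf : Differentiable ℂ f) (hg : Differentiable ℂ g)
    (h : ∀ x : ℝ, f x = g x) : f = g := by
  refine AnalyticOnNhd.eq_of_frequently_eq (z₀ := 0)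
    (fun z _ => hf.analyticAt z) (fun z _ => hg.analyticAt z) ?_
  have h1 : Tendsto (fun n : ℕ => ((1 / ((n : ℝ) + 1) : ℝ) : ℂ)) atTop (𝓝[≠] 0) := by
    rw [tendsto_nhdsWithin_iff]
    refine ⟨?_, Eventually.of_forall fun n => ?_⟩
    · have := (Complex.continuous_ofReal.tendsto 0).comp
        (tendsto_one_div_add_atTop_nhds_zero_nat (𝕜 := ℝ))
      simpa [Function.comp_def] using this
    · have : (0 : ℝ) < 1 / ((n : ℝ) + 1) := by positivity
      exact Complex.ofReal_ne_zero.2 this.ne'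
  exact h1.frequently (Frequently.of_forall fun n => h _)

/-- Paley–Wiener representation of entire functions of exponential type `2πh` in `L²(ℝ)`. -/
theorem exists_eq_pwTransform {h : ℝ} (hh : 0 ≤ h) {f : ℂ → ℂ} (hf : Differentiable ℂ f)
    (hexp : HasExpTypeLE (2 * Real.pi * h) f) (hL : MemLp (fun x : ℝ => f x) 2) :
    ∃ ψ : L2Icc h, f = pwTransform h ψ := by
  set Ψ : L2Line := 𝓕⁻ (hL.toLp _) with hΨ
  have hΨ0 : (Set.Icc (-h) h).indicator Ψ =ᵐ[volume] Ψ := by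
    filter_upwards [fourierInv_toLp_eq_zero (by positivity) hf hexp hL] with ξ hξ
    by_cases hm : ξ ∈ Set.Icc (-h) h
    · simp [Set.indicator_of_mem hm]
    · rw [Set.indicator_of_notMem hm, hξ]
      have : h < |ξ| := by
        by_contra hcon
        exact hm (abs_le.1 (not_lt.1 hcon))
      have hp := Real.pi_pos
      gcongr
  have hΨm : MemLp Ψ 2 (volume.restrict (Set.Icc (-h) h)) := (Lp.memLp Ψ).restrict _
  refine ⟨hΨm.toLp Ψ, ?_⟩
  rw [pwTransform_congr_ae hΨm.coeFn_toLp]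
  have hd := differentiable_pwTransform hh (ψ := Ψ) (hΨm.integrable (by norm_num))
  have hext : extendZero h (hΨm.toLp Ψ) = Ψ := by
    rw [extendZero_apply]
    exact Lp.ext ((MemLp.coeFn_toLp _).trans hΨ0)
  have hae := fourier_extendZero_ae_eq hΨm
  have hfe : 𝓕 Ψ = hL.toLp _ := by rw [hΨ]; exact FourierTransform.fourier_fourierInv_eq _
  rw [hext, hfe] at hae
  have hae2 : (fun x : ℝ => f x) =ᵐ[volume] fun x : ℝ => pwTransform h Ψ x :=
    hL.coeFn_toLp.symm.trans hae
  refine eq_of_eq_ofReal hf hd fun x => ?_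
  exact congrFun (((hf.continuous.comp Complex.continuous_ofReal).ae_eq_iff_eq volume
    (hd.continuous.comp Complex.continuous_ofReal)).1 hae2) x

/-- Multiplication by the bounded function `m` on `L²(ℝ)`. -/
def mulLine (m : Lp ℂ ∞ (volume : Measure ℝ)) : L2Line →L[ℂ] L2Line :=
  (ContinuousLinearMap.mul ℂ ℂ).holderL volume ∞ 2 2 m

theorem mulLine_ae_eq (m : Lp ℂ ∞ (volume : Measure ℝ)) (g : L2Line) :
    mulLine m g =ᵐ[volume] fun x => m x * g x :=
  (ContinuousLinearMap.mul ℂ ℂ).coeFn_holder m g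

/-- The compression to `L²[-h, h]` of the Fourier multiplier with symbol `m`: extend by zero, apply
`𝓕`, multiply by `m`, apply `𝓕⁻`, restrict. -/
def toeplitz (h : ℝ) (m : Lp ℂ ∞ (volume : Measure ℝ)) : L2Icc h →L[ℂ] L2Icc h :=
  LpToLpRestrictCLM ℝ ℂ ℂ volume 2 (Set.Icc (-h) h) ∘L
    ((Lp.fourierTransformₗᵢ ℝ ℂ).symm.toContinuousLinearEquiv : L2Line →L[ℂ] L2Line) ∘L
    mulLine m ∘L ((Lp.fourierTransformₗᵢ ℝ ℂ).toContinuousLinearEquiv : L2Line →L[ℂ] L2Line) ∘L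
    extendZero h

theorem toeplitz_apply {h : ℝ} (m : Lp ℂ ∞ (volume : Measure ℝ)) (ψ : L2Icc h) :
    toeplitz h m ψ = LpToLpRestrictCLM ℝ ℂ ℂ volume 2 (Set.Icc (-h) h)
      (𝓕⁻ (mulLine m (𝓕 (extendZero h ψ)))) := rfl

theorem inner_toeplitz {h : ℝ} (m : Lp ℂ ∞ (volume : Measure ℝ)) (φ ψ : L2Icc h) :
    ⟪toeplitz h m φ, ψ⟫_ℂ = ⟪mulLine m (𝓕 (extendZero h φ)), 𝓕 (extendZero h ψ)⟫_ℂ := by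
  rw [toeplitz_apply, ← ContinuousLinearMap.adjoint_inner_right, ← Lp.inner_fourier_eq,
    FourierTransform.fourier_fourierInv_eq]
  rfl

theorem inner_toeplitz_eq_integral {h : ℝ} {m : Lp ℂ ∞ (volume : Measure ℝ)} {r : ℝ → ℝ}
    (hm : m =ᵐ[volume] fun x => (r x : ℂ)) (φ ψ : L2Icc h) :
    ⟪toeplitz h m φ, ψ⟫_ℂ =
      ∫ x : ℝ, pwTransform h ψ x * conj (pwTransform h φ x) * r x := by
  have e : ∀ χ : L2Icc h, (𝓕 (extendZero h χ) : L2Line) =ᵐ[volume]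
      fun x : ℝ => pwTransform h χ x := fun χ => by
    have := fourier_extendZero_ae_eq (Lp.memLp χ)
    rwa [Lp.toLp_coeFn] at this
  rw [inner_toeplitz, L2.inner_def]
  refine integral_congr_ae ?_
  filter_upwards [mulLine_ae_eq m (𝓕 (extendZero h φ)), hm, e φ, e ψ] with x h1 h2 h3 h4
  rw [h1, h2, h3, h4, RCLike.inner_apply, map_mul, Complex.conj_ofReal]
  ring

/-- A symbol bounded below by `δ` gives a coercive operator. -/
theorem norm_sq_le_norm_inner_toeplitz {h : ℝ} {m : Lp ℂ ∞ (volume : Measure ℝ)} {r : ℝ → ℝ}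
    (hm : m =ᵐ[volume] fun x => (r x : ℂ)) {δ : ℝ} (hδ : 0 ≤ δ) (hr : ∀ x, δ ≤ r x)
    (ψ : L2Icc h) : ‖ψ‖ ^ 2 * δ ≤ ‖⟪toeplitz h m ψ, ψ⟫_ℂ‖ := by
  set g : L2Line := 𝓕 (extendZero h ψ) with hg
  have hgn : ‖g‖ = ‖ψ‖ := by rw [hg, Lp.norm_fourier_eq, norm_extendZero]
  have h1 : ⟪toeplitz h m ψ, ψ⟫_ℂ = ((∫ x, r x * ‖g x‖ ^ 2 : ℝ) : ℂ) := by
    rw [inner_toeplitz, L2.inner_def, ← integral_complex_ofReal]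
    refine integral_congr_ae ?_
    filter_upwards [mulLine_ae_eq m g, hm] with x h1 h2
    rw [← hg, h1, h2, RCLike.inner_apply, map_mul, Complex.conj_ofReal, mul_left_comm,
      Complex.mul_conj, Complex.normSq_eq_norm_sq]
    push_cast
    rfl
  have hmi : Integrable (fun x => r x * ‖g x‖ ^ 2) := by
    have := (L2.integrable_inner (𝕜 := ℂ) (mulLine m g) g).norm
    refine this.congr ?_
    filter_upwards [mulLine_ae_eq m g, hm] with x h1 h2
    rw [h1, h2, RCLike.inner_apply, norm_mul, RCLike.norm_conj, norm_mul, Complex.norm_real,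
      Real.norm_eq_abs, abs_of_nonneg (hδ.trans (hr x))]
    ring
  have hgi : Integrable (fun x => ‖g x‖ ^ 2) :=
    (memLp_two_iff_integrable_sq_norm (Lp.memLp g).1).1 (Lp.memLp g)
  have h2 : ‖g‖ ^ 2 = ∫ x, ‖g x‖ ^ 2 := by
    have := norm_toLp_sq (Lp.memLp g)
    rwa [Lp.toLp_coeFn] at this
  rw [h1, Complex.norm_real, ← hgn, h2, mul_comm, ← integral_const_mul]
  refine le_trans ?_ (le_abs_self _)
  exact integral_mono (hgi.const_mul δ) hmi fun x => by
    simp only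
    gcongr
    exact hr x

/-- The function representing evaluation at `w`; see `inner_conj_cexp`. -/
theorem memLp_conj_cexp (h : ℝ) (w : ℂ) :
    MemLp (fun α : ℝ => conj (Complex.exp (-2 * Real.pi * Complex.I * w * α))) 2
      (volume.restrict (Set.Icc (-h) h)) := by
  have : Continuous fun α : ℝ => conj (Complex.exp (-2 * Real.pi * Complex.I * w * α)) :=
    Complex.continuous_conj.comp (by fun_prop)
  exact MemLp.of_bound this.aestronglyMeasurable (Real.exp (2 * Real.pi * h * ‖w‖)) (by
    filter_upwards [ae_restrict_mem measurableSet_Icc] with α hα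
    rw [RCLike.norm_conj]
    exact norm_cexp_le_of_mem_Icc hα w)

theorem inner_conj_cexp {h : ℝ} (w : ℂ) (ψ : L2Icc h) :
    ⟪(memLp_conj_cexp h w).toLp _, ψ⟫_ℂ = pwTransform h ψ w := by
  rw [L2.inner_def]
  refine integral_congr_ae ?_
  filter_upwards [(memLp_conj_cexp h w).coeFn_toLp] with x hx
  rw [hx, RCLike.inner_apply]
  simp only [Complex.conj_conj]
  ring

section Kernel

variable {h δ R : ℝ} {ν : Measure ℝ} {r : ℝ → ℝ}

theorem memLp_of_mem_spaceH (hδ : 0 < δ) (hr : ∀ x, δ ≤ r x)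
    (hν : ∀ x, nuHat ν x = r x) {Δ : ℝ} {f : ℂ → ℂ} (hf : f ∈ spaceH Δ ν) :
    MemLp (fun x : ℝ => f x) 2 := by
  have hfc : Continuous fun x : ℝ => f x := hf.1.continuous.comp Complex.continuous_ofReal
  rw [memLp_two_iff_integrable_sq_norm hfc.aestronglyMeasurable]
  refine (hf.2.2.norm.const_mul δ⁻¹).mono' (hfc.norm.pow 2).aestronglyMeasurable
    (Eventually.of_forall fun x => ?_)
  rw [hν, norm_mul, Complex.norm_real, Complex.norm_real, Real.norm_eq_abs, Real.norm_eq_abs,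
    abs_of_nonneg (by positivity : 0 ≤ ‖f x‖ ^ 2), abs_of_pos (hδ.trans_le (hr x))]
  rw [inv_mul_eq_div, le_div_iff₀ hδ]
  exact mul_le_mul_of_nonneg_left (hr x) (by positivity)

theorem pwTransform_mem_spaceH (hh : 0 ≤ h) (hrc : Continuous r) (hδ : 0 < δ)
    (hr : ∀ x, δ ≤ r x) (hR : ∀ x, r x ≤ R) (hν : ∀ x, nuHat ν x = r x) {ψ : ℝ → ℂ}
    (hψ : MemLp ψ 2 (volume.restrict (Set.Icc (-h) h))) :
    pwTransform h ψ ∈ spaceH (2 * h) ν := by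
  have hi : IntegrableOn ψ (Set.Icc (-h) h) := hψ.integrable (by norm_num)
  have hd := differentiable_pwTransform hh hi
  refine ⟨hd, ?_, ?_⟩
  · have := hasExpTypeLE_pwTransform hi
    rwa [show Real.pi * (2 * h) = 2 * Real.pi * h by ring]
  · have hc : Continuous fun x : ℝ => pwTransform h ψ x :=
      hd.continuous.comp Complex.continuous_ofReal
    have h2 := (memLp_two_iff_integrable_sq_norm hc.aestronglyMeasurable).1 (memLp_pwTransform hψ)
    simp_rw [hν]
    refine (h2.const_mul R).mono' (by fun_prop) (Eventually.of_forall fun x => ?_)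
    rw [norm_mul, Complex.norm_real, Complex.norm_real, Real.norm_eq_abs, Real.norm_eq_abs,
      abs_of_nonneg (by positivity : 0 ≤ ‖pwTransform h ψ x‖ ^ 2),
      abs_of_pos (hδ.trans_le (hr x)), mul_comm]
    exact mul_le_mul_of_nonneg_right (hR x) (by positivity)

theorem mem_spaceH_iff (hh : 0 ≤ h) (hrc : Continuous r) (hδ : 0 < δ)
    (hr : ∀ x, δ ≤ r x) (hR : ∀ x, r x ≤ R) (hν : ∀ x, nuHat ν x = r x) {f : ℂ → ℂ} :
    f ∈ spaceH (2 * h) ν ↔ ∃ ψ : L2Icc h, f = pwTransform h ψ := by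
  constructor
  · intro hf
    have h1 := hf.2.1
    rw [show Real.pi * (2 * h) = 2 * Real.pi * h by ring] at h1
    exact exists_eq_pwTransform hh hf.1 h1 (memLp_of_mem_spaceH hδ hr hν hf)
  · rintro ⟨ψ, rfl⟩
    exact pwTransform_mem_spaceH hh hrc hδ hr hR hν (Lp.memLp ψ)

theorem nuInner_conj_symm (hν : ∀ x, nuHat ν x = r x) (f g : ℂ → ℂ) :
    conj (nuInner ν f g) = nuInner ν g f := by
  rw [nuInner, nuInner, ← integral_conj]
  refine integral_congr_ae (Eventually.of_forall fun x => ?_)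
  simp only [hν, map_mul, Complex.conj_conj, Complex.conj_ofReal]
  ring

/-- A function with the reproducing property at a single point `w` is the value at `w` of every
reproducing kernel. -/
theorem eq_reproducingKernel {Δ : ℝ} (hν : ∀ x, nuHat ν x = r x) {K : ℂ → ℂ → ℂ}
    (hK : IsReproducingKernel Δ ν K) {w : ℂ} {k : ℂ → ℂ} (hk : k ∈ spaceH Δ ν)
    (hrep : ∀ f ∈ spaceH Δ ν, f w = nuInner ν f k) : K w = k := by
  funext z
  rw [hK.2 k hk z, hK.2 (K w) (hK.1 w) z, ← nuInner_conj_symm hν (K z) k, ← hrep _ (hK.1 z),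
    hK.2 (K z) (hK.1 z) w, nuInner_conj_symm hν]

/-- Existence of a reproducing kernel, with the integral equation that determines it. -/
theorem exists_reproducingKernel (hh : 0 ≤ h) (hrc : Continuous r) (hδ : 0 < δ)
    (hr : ∀ x, δ ≤ r x) (hR : ∀ x, r x ≤ R) (hν : ∀ x, nuHat ν x = r x)
    {m : Lp ℂ ∞ (volume : Measure ℝ)} (hm : m =ᵐ[volume] fun x => (r x : ℂ)) :
    ∃ K, IsReproducingKernel (2 * h) ν K ∧ ∀ w (κ : L2Icc h),
      toeplitz h m κ = (memLp_conj_cexp h w).toLp _ → K w = pwTransform h κ := by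
  have hrep : ∀ w (κ : L2Icc h), toeplitz h m κ = (memLp_conj_cexp h w).toLp _ →
      ∀ f ∈ spaceH (2 * h) ν, f w = nuInner ν f (pwTransform h κ) := by
    intro w κ hκ f hf
    obtain ⟨ψ, rfl⟩ := (mem_spaceH_iff hh hrc hδ hr hR hν).1 hf
    rw [← inner_conj_cexp, ← hκ, inner_toeplitz_eq_integral hm, nuInner]
    simp_rw [hν]
  have hu : IsUnit (toeplitz h m) :=
    ContinuousLinearMap.isUnit_of_forall_le_norm_inner_map _ (c := ⟨δ, hδ.le⟩) hδ
      (norm_sq_le_norm_inner_toeplitz hm hδ.le hr)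
  have hsurj := (ContinuousLinearMap.isUnit_iff_bijective.1 hu).2
  choose κ hκ using fun w => hsurj ((memLp_conj_cexp h w).toLp _)
  have hK : IsReproducingKernel (2 * h) ν (fun w => pwTransform h (κ w)) :=
    ⟨fun w => (mem_spaceH_iff hh hrc hδ hr hR hν).2 ⟨κ w, rfl⟩,
      fun f hf w => hrep w (κ w) (hκ w) f hf⟩
  exact ⟨_, hK, fun w κ' hκ' => eq_reproducingKernel hν hK
    ((mem_spaceH_iff hh hrc hδ hr hR hν).2 ⟨κ', rfl⟩) (hrep w κ' hκ')⟩

end Kernel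

/-! ### The operator on continuous functions -/

/-- The operator `u ↦ c₁ u + c₂ ∫_{-h}^{h} k(· - β) u(β) dβ` with `k(α) = |α| e^{-c₃|α|}`. -/
def convOp (c₁ c₂ c₃ h : ℝ) (u : ℝ → ℂ) (α : ℝ) : ℂ :=
  c₁ * u α + c₂ * ∫ β in (-h)..h, (absExpKernel c₃ (α - β) : ℂ) * u β

theorem absExpKernel_le {c Δ α : ℝ} (hc : 0 ≤ c) (hα : |α| ≤ Δ) : absExpKernel c α ≤ Δ := by
  have h1 : Real.exp (-c * |α|) ≤ 1 := Real.exp_le_one_iff.2 (by nlinarith [abs_nonneg α])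
  unfold absExpKernel
  nlinarith [abs_nonneg α, Real.exp_pos (-c * |α|)]

theorem memLp_of_continuous {h : ℝ} {u : ℝ → ℂ} (hu : Continuous u) :
    MemLp u 2 (volume.restrict (Set.Icc (-h) h)) := by
  obtain ⟨C, hC⟩ := isCompact_Icc.exists_bound_of_continuousOn (s := Set.Icc (-h) h) hu.continuousOn
  exact MemLp.of_bound hu.aestronglyMeasurable C
    ((ae_restrict_iff' measurableSet_Icc).2 (Eventually.of_forall hC))

/-- On continuous functions the operator with symbol `ν̂` is `convOp`. The symbol only sees `k` on
`[-2h, 2h]`, which is where the differences of points of `[-h, h]` lie. -/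
theorem toeplitz_toLp_ae_eq {c₁ c₂ c₃ h : ℝ} (hh : 0 ≤ h) (hc₃ : 0 ≤ c₃)
    {m : Lp ℂ ∞ (volume : Measure ℝ)}
    (hm : m =ᵐ[volume] fun x => (c₁ + c₂ * ∫ α in Set.Icc (-(2 * h)) (2 * h),
      Complex.exp (-2 * Real.pi * Complex.I * x * α) * absExpKernel c₃ α : ℂ))
    {u : ℝ → ℂ} (hu : Continuous u) :
    toeplitz h m ((memLp_of_continuous hu).toLp u) =ᵐ[volume.restrict (Set.Icc (-h) h)]
      convOp c₁ c₂ c₃ h u := by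
  set k : ℝ → ℂ := (Set.Icc (-(2 * h)) (2 * h)).indicator fun α => (absExpKernel c₃ α : ℂ) with hk
  set v : ℝ → ℂ := (Set.Icc (-h) h).indicator u with hv
  have hcc := continuous_absExpKernel c₃
  have hkc : Continuous fun α => (absExpKernel c₃ α : ℂ) := by fun_prop
  have hki : Integrable k := (integrable_indicator_iff measurableSet_Icc).2
    (hkc.continuousOn.integrableOn_compact isCompact_Icc)
  have hvi : Integrable v := integrable_indicator_of_memLp (memLp_of_continuous hu)
  have hv2 : MemLp v 2 := memLp_indicator (memLp_of_continuous hu)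
  have hkb : ∀ x, ‖k x‖ ≤ 2 * h := by
    intro x
    by_cases hx : x ∈ Set.Icc (-(2 * h)) (2 * h)
    · rw [hk, Set.indicator_of_mem hx, Complex.norm_real, Real.norm_eq_abs,
        abs_of_nonneg (absExpKernel_nonneg _ _)]
      exact absExpKernel_le hc₃ (abs_le.2 hx)
    · rw [hk, Set.indicator_of_notMem hx, norm_zero]
      linarith
  set w : ℝ → ℂ := k ⋆[ContinuousLinearMap.mul ℂ ℂ] v with hw
  have hwi : Integrable w := hki.integrable_convolution _ hvi
  have hwv : ∀ x, w x = ∫ β in Set.Icc (-h) h, k (x - β) * u β := by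
    intro x
    rw [hw, convolution_mul_swap, ← integral_indicator measurableSet_Icc]
    refine integral_congr_ae (Eventually.of_forall fun β => ?_)
    by_cases hβ : β ∈ Set.Icc (-h) h
    · simp [hv, Set.indicator_of_mem hβ]
    · simp [hv, Set.indicator_of_notMem hβ]
  have hwb : ∀ x, ‖w x‖ ≤ 2 * h * ∫ β in Set.Icc (-h) h, ‖u β‖ := by
    intro x
    rw [hwv, ← integral_const_mul]
    refine norm_integral_le_of_norm_le ((hu.norm.continuousOn.integrableOn_compact
      isCompact_Icc).const_mul _) (Eventually.of_forall fun β => ?_)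
    rw [norm_mul]
    gcongr
    exact hkb _
  have hw2 : MemLp w 2 := by
    rw [memLp_two_iff_integrable_sq_norm hwi.aestronglyMeasurable]
    refine (hwi.norm.const_mul (2 * h * ∫ β in Set.Icc (-h) h, ‖u β‖)).mono'
      (hwi.aestronglyMeasurable.norm.pow 2)
      (Eventually.of_forall fun x => ?_)
    rw [Real.norm_eq_abs, abs_of_nonneg (by positivity), sq]
    exact mul_le_mul_of_nonneg_right (hwb x) (norm_nonneg _)
  set G : ℝ → ℂ := fun x => c₁ * v x + c₂ * w x with hG
  have hGi : Integrable G := (hvi.const_mul _).add (hwi.const_mul _)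
  have hG2 : MemLp G 2 := (hv2.const_mul (c₁ : ℂ)).add (hw2.const_mul (c₂ : ℂ))
  have hFG : ∀ x, 𝓕 G x = (c₁ + c₂ * 𝓕 k x) * 𝓕 v x := by
    intro x
    have h1 : 𝓕 w x = 𝓕 k x * 𝓕 v x := Real.fourier_mul_convolution_eq hki hvi x
    have h2 : 𝓕 G x = c₁ * 𝓕 v x + c₂ * 𝓕 w x := by
      simp only [Real.fourier_real_eq_integral_exp_smul, smul_eq_mul]
      have hb : ∀ {g : ℝ → ℂ}, Integrable g → Integrable fun a : ℝ =>
          Complex.exp (((-2 * Real.pi * a * x : ℝ) : ℂ) * Complex.I) * g a := fun hg =>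
        hg.bdd_mul (c := 1) (by fun_prop) (Eventually.of_forall fun a => by
          rw [Complex.norm_exp_ofReal_mul_I])
      rw [← integral_const_mul, ← integral_const_mul,
        ← integral_add ((hb hvi).const_mul _) ((hb hwi).const_mul _)]
      refine integral_congr_ae (Eventually.of_forall fun a => ?_)
      simp only [hG]
      ring
    rw [h2, h1]; ring
  have hkF : ∀ x : ℝ, 𝓕 k x = ∫ α in Set.Icc (-(2 * h)) (2 * h),
      Complex.exp (-2 * Real.pi * Complex.I * x * α) * absExpKernel c₃ α := fun x =>
    (pwTransform_ofReal (2 * h) (fun α => (absExpKernel c₃ α : ℂ)) x).symm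
  have hMG : mulLine m (𝓕 (extendZero h ((memLp_of_continuous hu).toLp u))) = 𝓕 (hG2.toLp G) := by
    refine Lp.ext ?_
    filter_upwards [mulLine_ae_eq m (𝓕 (extendZero h ((memLp_of_continuous hu).toLp u))), hm,
      fourier_extendZero_ae_eq (memLp_of_continuous (h := h) hu), fourier_toLp_ae_eq hGi hG2]
      with x h1 h2 h3 h4
    rw [h1, h2, h3, h4, hFG, hkF, pwTransform_ofReal]
  rw [toeplitz_apply, hMG, FourierTransform.fourierInv_fourier_eq]
  filter_upwards [LpToLpRestrictCLM_coeFn ℂ (Set.Icc (-h) h) (hG2.toLp G),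
    ae_restrict_of_ae hG2.coeFn_toLp, ae_restrict_mem measurableSet_Icc] with α h1 h2 hα
  rw [h1, h2, convOp, intervalIntegral.integral_of_le (by linarith), ← integral_Icc_eq_integral_Ioc]
  simp only [hG, hwv]
  rw [hv, Set.indicator_of_mem hα]
  congr 2
  refine setIntegral_congr_fun measurableSet_Icc fun β hβ => ?_
  rw [hk, Set.indicator_of_mem]
  exact ⟨by linarith [hα.1, hβ.2], by linarith [hα.2, hβ.1]⟩

theorem eq_zero_of_convOp_eq_zero {c₁ c₂ c₃ h δ : ℝ} (hh : 0 < h) (hc₃ : 0 ≤ c₃)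
    {m : Lp ℂ ∞ (volume : Measure ℝ)}
    (hm : m =ᵐ[volume] fun x => (c₁ + c₂ * ∫ α in Set.Icc (-(2 * h)) (2 * h),
      Complex.exp (-2 * Real.pi * Complex.I * x * α) * absExpKernel c₃ α : ℂ))
    {r : ℝ → ℝ} (hmr : m =ᵐ[volume] fun x => (r x : ℂ)) (hδ : 0 < δ) (hr : ∀ x, δ ≤ r x)
    {u : ℝ → ℂ} (hu : Continuous u) (h0 : ∀ α ∈ Set.Icc (-h) h, convOp c₁ c₂ c₃ h u α = 0) :
    ∀ α ∈ Set.Icc (-h) h, u α = 0 := by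
  have h1 : toeplitz h m ((memLp_of_continuous hu).toLp u) = 0 := by
    refine Lp.ext ?_
    filter_upwards [toeplitz_toLp_ae_eq hh.le hc₃ hm hu, ae_restrict_mem measurableSet_Icc,
      Lp.coeFn_zero ℂ 2 (volume.restrict (Set.Icc (-h) h))] with α h2 h3 h4
    rw [h2, h4, h0 α h3]; rfl
  have h2 := norm_sq_le_norm_inner_toeplitz hmr hδ.le hr ((memLp_of_continuous (h := h) hu).toLp u)
  rw [h1, inner_zero_left, norm_zero] at h2
  have h3 : (memLp_of_continuous (h := h) hu).toLp u = 0 := by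
    rw [← norm_eq_zero]
    by_contra hne
    have : 0 < ‖(memLp_of_continuous (h := h) hu).toLp u‖ :=
      lt_of_le_of_ne (norm_nonneg _) (Ne.symm hne)
    have : 0 < ‖(memLp_of_continuous (h := h) hu).toLp u‖ ^ 2 * δ := by positivity
    linarith
  have h4 : u =ᵐ[volume.restrict (Set.Icc (-h) h)] fun _ => 0 := by
    have := (memLp_of_continuous (h := h) hu).coeFn_toLp
    rw [h3] at this
    exact this.symm.trans (Lp.coeFn_zero ℂ 2 _)
  exact Measure.eqOn_Icc_of_ae_eq volume (by linarith : -h ≠ h) h4 hu.continuousOn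
    continuousOn_const

theorem pwTransform_zero_eq {h : ℝ} (hh : 0 ≤ h) (u : ℝ → ℂ) :
    pwTransform h u 0 = ∫ α in (-h)..h, u α := by
  rw [intervalIntegral.integral_of_le (by linarith), ← integral_Icc_eq_integral_Ioc, pwTransform]
  simp

/-- Existence and uniqueness of the reproducing kernel of `H_ν`, its value at the origin in terms of
a continuous solution of `convOp u = 1`, and the injectivity of `convOp` on continuous functions. -/
theorem exists_reproducingKernel_nuMeasure {h c₁ c₂ c₃ : ℝ} (hh : 0 < h) (hc₁ : 0 < c₁)
    (hc₂ : 0 < c₂) (hc₃ : 0 < c₃) (hbound : c₂ / c₁ * (2 * h) ^ 2 ≤ 5 / 3) :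
    ∃ K : ℂ → ℂ → ℂ, IsReproducingKernel (2 * h) (nuMeasure (2 * h) c₁ c₂ c₃) K ∧
      (∀ K', IsReproducingKernel (2 * h) (nuMeasure (2 * h) c₁ c₂ c₃) K' → K' = K) ∧
      (∀ u : ℝ → ℂ, Continuous u → (∀ α ∈ Set.Icc (-h) h, convOp c₁ c₂ c₃ h u α = 1) →
        K 0 0 = ∫ α in (-h)..h, u α) ∧
      ∀ u : ℝ → ℂ, Continuous u → (∀ α ∈ Set.Icc (-h) h, convOp c₁ c₂ c₃ h u α = 0) →
        ∀ α ∈ Set.Icc (-h) h, u α = 0 := by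
  have hΔ : 0 ≤ 2 * h := by linarith
  set r := nuHatReal (2 * h) c₁ c₂ c₃ with hrdef
  have hν : ∀ x, nuHat (nuMeasure (2 * h) c₁ c₂ c₃) x = r x := nuHat_eq_ofReal hΔ hc₁ hc₂
  have hrc : Continuous r := continuous_nuHatReal _ _ _ _
  have hδ : 0 < c₁ / 1000 := by positivity
  have hr : ∀ x, c₁ / 1000 ≤ r x := le_nuHatReal hΔ hc₁ hc₂ hc₃.le hbound
  have hR : ∀ x, r x ≤ c₁ + 2 * c₂ * (2 * h * (2 * h)) := nuHatReal_le hΔ hc₂ hc₃.le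
  have hmem : MemLp (fun x => (r x : ℂ)) ∞ (volume : Measure ℝ) :=
    memLp_top_of_bound (by fun_prop) (c₁ + 2 * c₂ * (2 * h * (2 * h)))
      (Eventually.of_forall fun x => by
        rw [Complex.norm_real, Real.norm_eq_abs, abs_of_pos (hδ.trans_le (hr x))]; exact hR x)
  have hmr := hmem.coeFn_toLp
  have hm : hmem.toLp _ =ᵐ[volume] fun x => (c₁ + c₂ * ∫ α in Set.Icc (-(2 * h)) (2 * h),
      Complex.exp (-2 * Real.pi * Complex.I * x * α) * absExpKernel c₃ α : ℂ) := by
    filter_upwards [hmr] with x hx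
    rw [hx, ← hν, nuHat_eq_setIntegral hc₁ hc₂]
  obtain ⟨K, hK, hKu⟩ := exists_reproducingKernel hh.le hrc hδ hr hR hν hmr
  refine ⟨K, hK, fun K' hK' => funext fun w => eq_reproducingKernel hν hK' (hK.1 w)
    (fun f hf => hK.2 f hf w), fun u hu hu1 => ?_, fun u hu hu0 =>
    eq_zero_of_convOp_eq_zero hh hc₃.le hm hmr hδ hr hu hu0⟩
  have hT : toeplitz h (hmem.toLp _) ((memLp_of_continuous hu).toLp u) =
      (memLp_conj_cexp h 0).toLp _ := by
    refine Lp.ext ?_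
    filter_upwards [toeplitz_toLp_ae_eq hh.le hc₃.le hm hu, ae_restrict_mem measurableSet_Icc,
      (memLp_conj_cexp h 0).coeFn_toLp] with α h2 h3 h4
    rw [h2, h4, hu1 α h3]; simp
  rw [hKu 0 _ hT, pwTransform_congr_ae (memLp_of_continuous hu).coeFn_toLp,
    pwTransform_zero_eq hh.le]

/-! ### The operator on hyperbolic cosines -/

theorem integral_sub_mul_exp_left {c α : ℝ} {η : ℂ} (h : ℝ) (hs : (c : ℂ) + η ≠ 0) :
    ∫ β in (-h)..α, ((α : ℂ) - β) * Complex.exp (-c * (α - β)) * Complex.exp (η * β) =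
      Complex.exp (η * α) / (c + η) ^ 2 - Complex.exp (-c * α) * Complex.exp (-(c + η) * h) *
        ((α + h) / (c + η) + 1 / (c + η) ^ 2) := by
  have hd : ∀ β : ℝ, HasDerivAt (fun β : ℝ => Complex.exp (-c * α) *
      (((α : ℂ) - β) * Complex.exp ((c + η) * β) / (c + η) +
        Complex.exp ((c + η) * β) / (c + η) ^ 2))
      (((α : ℂ) - β) * Complex.exp (-c * (α - β)) * Complex.exp (η * β)) β := by
    intro β
    have h0 : HasDerivAt (fun β : ℝ => (β : ℂ)) 1 β := Complex.ofRealCLM.hasDerivAt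
    have h1 := (h0.const_mul ((c : ℂ) + η)).cexp
    refine ((((h0.const_sub (α : ℂ)).mul h1).div_const (c + η)).add
      (h1.div_const ((c + η) ^ 2))).const_mul (Complex.exp (-c * α)) |>.congr_deriv ?_
    have e1 : Complex.exp (-c * (α - β)) * Complex.exp (η * β) =
        Complex.exp (-c * α) * Complex.exp ((c + η) * β) := by
      rw [← Complex.exp_add, ← Complex.exp_add]; ring_nf
    rw [mul_assoc ((α : ℂ) - β), e1]
    field_simp
    ring
  rw [intervalIntegral.integral_eq_sub_of_hasDerivAt (fun β _ => hd β)
    ((by fun_prop : Continuous fun β : ℝ => ((α : ℂ) - β) * Complex.exp (-c * (α - β)) *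
      Complex.exp (η * β)).intervalIntegrable _ _)]
  have e2 : Complex.exp (-c * α) * Complex.exp ((c + η) * α) = Complex.exp (η * α) := by
    rw [← Complex.exp_add]; ring_nf
  rw [← e2]
  push_cast
  rw [show ((c : ℂ) + η) * -(h : ℂ) = -(c + η) * h by ring]
  ring

/-- Closed form of `∫_{-h}^{α} (α - β) e^{-c(α - β)} e^{ηβ} dβ`, see `integral_sub_mul_exp_left`. -/
def halfKernel (c h : ℝ) (η : ℂ) (α : ℝ) : ℂ :=
  Complex.exp (η * α) / (c + η) ^ 2 - Complex.exp (-c * α) * Complex.exp (-(c + η) * h) *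
    ((α + h) / (c + η) + 1 / (c + η) ^ 2)

theorem integral_absExpKernel_mul_exp {c h α : ℝ} {η : ℂ} (h1 : (c : ℂ) + η ≠ 0) (h2 : (c : ℂ) - η ≠ 0)
    (hα : α ∈ Set.Icc (-h) h) :
    ∫ β in (-h)..h, (absExpKernel c (α - β) : ℂ) * Complex.exp (η * β) =
      halfKernel c h η α + halfKernel c h (-η) (-α) := by
  have hcc := continuous_absExpKernel c
  have hi : ∀ a b, IntervalIntegrable (fun β : ℝ => (absExpKernel c (α - β) : ℂ) * Complex.exp (η * β))
    volume a b := fun a b => (by fun_prop : Continuous _).intervalIntegrable _ _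
  rw [← intervalIntegral.integral_add_adjacent_intervals (hi (-h) α) (hi α h)]
  congr 1
  · rw [halfKernel, ← integral_sub_mul_exp_left h h1]
    refine intervalIntegral.integral_congr fun β hβ => ?_
    rw [Set.uIcc_of_le hα.1] at hβ
    simp only [absExpKernel]
    rw [abs_of_nonneg (by linarith [hβ.2])]
    push_cast
    rfl
  · rw [halfKernel, ← integral_sub_mul_exp_left h (by simpa [sub_eq_add_neg] using h2)]
    have := intervalIntegral.integral_comp_neg (a := -h) (b := -α)
      (f := fun β : ℝ => (absExpKernel c (α - β) : ℂ) * Complex.exp (η * β))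
    rw [neg_neg, neg_neg] at this
    rw [← this]
    refine intervalIntegral.integral_congr fun β hβ => ?_
    rw [Set.uIcc_of_le (by linarith [hα.2])] at hβ
    simp only [absExpKernel]
    rw [abs_of_nonpos (by linarith [hβ.2])]
    push_cast
    ring_nf

theorem integral_absExpKernel_mul_cosh {c h α : ℝ} {η : ℂ} (h1 : (c : ℂ) + η ≠ 0)
    (h2 : (c : ℂ) - η ≠ 0) (hα : α ∈ Set.Icc (-h) h) :
    ∫ β in (-h)..h, (absExpKernel c (α - β) : ℂ) * Complex.cosh (η * β) =
      (halfKernel c h η α + halfKernel c h (-η) (-α) +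
        (halfKernel c h (-η) α + halfKernel c h η (-α))) / 2 := by
  have hcc := continuous_absExpKernel c
  have hi : ∀ η : ℂ, IntervalIntegrable (fun β : ℝ => (absExpKernel c (α - β) : ℂ) * Complex.exp (η * β))
    volume (-h) h := fun η => (by fun_prop : Continuous _).intervalIntegrable _ _
  have e1 := integral_absExpKernel_mul_exp h1 h2 hα
  have e2 := integral_absExpKernel_mul_exp (η := -η) (h := h) (α := α) (c := c)
    (by simpa [sub_eq_add_neg] using h2) (by simpa using h1) hα
  rw [neg_neg] at e2
  rw [← e1, ← e2, ← intervalIntegral.integral_add (hi _) (hi _), ← intervalIntegral.integral_div]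
  refine intervalIntegral.integral_congr fun β _ => ?_
  simp only [Complex.cosh, neg_mul]
  ring

theorem integral_exp_neg_abs_mul_cosh {c h : ℝ} (hh : 0 ≤ h) {η : ℂ} (h1 : (c : ℂ) + η ≠ 0)
    (h2 : (c : ℂ) - η ≠ 0) :
    ∫ β in (-h)..h, Complex.cosh (η * β) * ((Real.exp (-c * |β|) : ℝ) : ℂ) =
      (1 - Complex.exp (-(c + η) * h)) / (c + η) + (1 - Complex.exp (-(c - η) * h)) / (c - η) := by
  set F : ℝ → ℂ := fun β => Complex.cosh (η * β) * ((Real.exp (-c * |β|) : ℝ) : ℂ) with hF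
  have hFc : Continuous F := by
    have : Continuous Complex.cosh := Complex.continuous_cosh
    fun_prop
  have hi : ∀ a b, IntervalIntegrable F volume a b := fun a b => hFc.intervalIntegrable _ _
  have hneg : ∫ β in (-h)..0, F β = ∫ β in (0:ℝ)..h, F β := by
    have := intervalIntegral.integral_comp_neg (a := -h) (b := 0) (f := F)
    rw [neg_neg, neg_zero] at this
    rw [← this]
    refine intervalIntegral.integral_congr fun β _ => ?_
    simp [hF]
  have hpos : ∫ β in (0:ℝ)..h, F β =
      ∫ β in (0:ℝ)..h, (Complex.exp (-(c - η) * β) + Complex.exp (-(c + η) * β)) / 2 := by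
    refine intervalIntegral.integral_congr fun β hβ => ?_
    rw [Set.uIcc_of_le hh] at hβ
    simp only [hF, Complex.cosh]
    rw [abs_of_nonneg hβ.1]
    push_cast
    rw [div_mul_eq_mul_div, add_mul, ← Complex.exp_add, ← Complex.exp_add]
    ring_nf
  have he : ∀ s : ℂ, IntervalIntegrable (fun β : ℝ => Complex.exp (s * β)) volume 0 h :=
    fun s => (by fun_prop : Continuous _).intervalIntegrable _ _
  rw [← intervalIntegral.integral_add_adjacent_intervals (hi (-h) 0) (hi 0 h), hneg, hpos,
    intervalIntegral.integral_div, intervalIntegral.integral_add (he _) (he _),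
    integral_exp_mul_complex (neg_ne_zero.2 h2), integral_exp_mul_complex (neg_ne_zero.2 h1)]
  simp only [Complex.ofReal_zero, mul_zero, Complex.exp_zero]
  rw [div_neg, div_neg]
  ring

/-- The factor `Q(η, α)` of the characteristic polynomial in the image of `cosh(ηα)`, see
`convOp_cosh`. -/
def defect (c : ℝ) (η : ℂ) (α : ℝ) : ℂ :=
  (Complex.cosh (η * α) - Complex.cosh (c * α)) / (η ^ 2 - c ^ 2) ^ 2 -
    α * Complex.sinh (c * α) / (2 * c * (η ^ 2 - c ^ 2))

theorem charPoly_eval (c₁ c₂ c₃ : ℝ) (η : ℂ) : (charPoly c₁ c₂ c₃).eval η =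
    c₁ * η ^ 4 + 2 * (c₂ - c₁ * c₃ ^ 2) * η ^ 2 + c₃ ^ 2 * (2 * c₂ + c₁ * c₃ ^ 2) := by
  simp [charPoly]

theorem auxA_eq_integral_absExpKernel (h c₁ c₂ c₃ : ℝ) (η : ℂ) : auxA (2 * h) c₁ c₂ c₃ η =
    1 + (c₂ / c₁ : ℂ) * ∫ β in (-h)..h, (absExpKernel c₃ β : ℂ) * Complex.cosh (η * β) := by
  rw [auxA, show -(2 * h) / 2 = -h by ring, show 2 * h / 2 = h by ring]
  simp_rw [absExpKernel, mul_comm]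

/-- The image of `cosh(ηα)`. It solves `(D² - c₃²)² g = P(η) cosh(ηα)`; the first two terms
are the even homogeneous solution with the right value and second derivative at zero, and
`P(η) Q(η, α)` is a particular solution that contributes nothing to these. -/
theorem convOp_cosh {h c₁ c₂ c₃ : ℝ} (hh : 0 ≤ h) (hc₁ : 0 < c₁) (hc₃ : 0 < c₃)
    {η : ℂ} (hη : η ^ 2 ≠ (c₃ : ℂ) ^ 2) {α : ℝ} (hα : α ∈ Set.Icc (-h) h) :
    convOp c₁ c₂ c₃ h (fun β => Complex.cosh (η * β)) α =
      c₁ * auxA (2 * h) c₁ c₂ c₃ η * Complex.cosh (c₃ * α) +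
        c₁ * auxB (2 * h) c₁ c₂ c₃ η * (α * Complex.sinh (c₃ * α) / (2 * c₃)) +
        (charPoly c₁ c₂ c₃).eval η * defect c₃ η α := by
  have h1 : (c₃ : ℂ) + η ≠ 0 := fun h0 => hη (by
    rw [eq_neg_of_add_eq_zero_right h0]; ring)
  have h2 : (c₃ : ℂ) - η ≠ 0 := fun h0 => hη (by rw [sub_eq_zero.1 h0])
  have h1' : (c₃ : ℂ) + -η ≠ 0 := by rwa [← sub_eq_add_neg]
  have hc₁' : (c₁ : ℂ) ≠ 0 := by exact_mod_cast hc₁.ne'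
  have hc₃' : (c₃ : ℂ) ≠ 0 := by exact_mod_cast hc₃.ne'
  have hJ0 := integral_absExpKernel_mul_cosh (h := h) (α := 0) h1 h2 ⟨by linarith, hh⟩
  simp only [zero_sub, absExpKernel_neg] at hJ0
  have hA : c₁ * auxA (2 * h) c₁ c₂ c₃ η = c₁ + c₂ * ((halfKernel c₃ h η 0 +
      halfKernel c₃ h (-η) (-0) + (halfKernel c₃ h (-η) 0 + halfKernel c₃ h η (-0))) / 2) := by
    rw [auxA_eq_integral_absExpKernel, hJ0]
    field_simp
  have hB : c₁ * auxB (2 * h) c₁ c₂ c₃ η = c₁ * η ^ 2 + 2 * c₂ - c₁ * c₃ ^ 2 - 2 * c₂ * c₃ *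
      ((1 - Complex.exp (-(c₃ + η) * h)) / (c₃ + η) +
        (1 - Complex.exp (-(c₃ - η) * h)) / (c₃ - η)) := by
    rw [auxB, show -(2 * h) / 2 = -h by ring, show 2 * h / 2 = h by ring,
      integral_exp_neg_abs_mul_cosh hh h1 h2]
    field_simp
  rw [hA, hB, convOp, integral_absExpKernel_mul_cosh h1 h2 hα, charPoly_eval, defect]
  have hsq : η ^ 2 - (c₃ : ℂ) ^ 2 = -((c₃ + η) * (c₃ - η)) := by ring
  rw [hsq]
  simp only [halfKernel, Complex.cosh, Complex.sinh]
  have em : (c₃ : ℂ) + -η = c₃ - η := by ring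
  have e1 : -(c₃ : ℂ) * ((-α : ℝ) : ℂ) = c₃ * α := by push_cast; ring
  have e2 : -η * ((-α : ℝ) : ℂ) = η * α := by push_cast; ring
  have e3 : η * ((-α : ℝ) : ℂ) = -(η * α) := by push_cast; ring
  have e4 : -η * (α : ℂ) = -(η * α) := by ring
  have e5 : -(c₃ : ℂ) * (α : ℂ) = -(c₃ * α) := by ring
  rw [em, e1, e2, e3, e4, e5]
  simp only [neg_zero, Complex.ofReal_zero, mul_zero, Complex.exp_zero, Complex.ofReal_neg]
  generalize Complex.exp (-((c₃ : ℂ) + η) * h) = E1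
  generalize Complex.exp (-((c₃ : ℂ) - η) * h) = E2
  generalize Complex.exp (η * α) = G1
  generalize Complex.exp (-(η * α)) = G2
  generalize Complex.exp ((c₃ : ℂ) * α) = H1
  generalize Complex.exp (-((c₃ : ℂ) * α)) = H2
  -- partial fractions in the variables `p = c₃ + η` and `q = c₃ - η`
  obtain ⟨p, hp⟩ : ∃ p, p = (c₃ : ℂ) + η := ⟨_, rfl⟩
  obtain ⟨q, hq⟩ : ∃ q, q = (c₃ : ℂ) - η := ⟨_, rfl⟩
  rw [← hp, ← hq]
  rw [← hp] at h1
  rw [← hq] at h2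
  have hcp : (c₃ : ℂ) = (p + q) / 2 := by rw [hp, hq]; ring
  have hηp : η = (p - q) / 2 := by rw [hp, hq]; ring
  rw [hcp] at hc₃' ⊢
  have hpq : p + q ≠ 0 := fun h0 => hc₃' (by rw [h0, zero_div])
  rw [hηp]
  clear * - h1 h2 hpq
  field_simp
  ring

/-! ### Derivatives in the parameter, and the linear system -/

theorem hasDerivAt_integral_mul_cosh {g : ℝ → ℂ} (hg : Continuous g) {h : ℝ} (hh : 0 ≤ h) (η₀ : ℂ) :
    HasDerivAt (fun η : ℂ => ∫ β in (-h)..h, g β * Complex.cosh (η * β))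
      (∫ β in (-h)..h, g β * (β * Complex.sinh (η₀ * β))) η₀ := by
  have hcosh := Complex.continuous_cosh
  have hsinh := Complex.continuous_sinh
  have hb : ∀ η ∈ Metric.ball η₀ 1, ∀ β ∈ Set.Icc (-h) h,
      ‖g β * (β * Complex.sinh (η * β))‖ ≤ ‖g β‖ * (h * Real.exp ((‖η₀‖ + 1) * h)) := by
    intro η hη β hβ
    have hη' : ‖η‖ ≤ ‖η₀‖ + 1 := by
      have := norm_le_norm_add_norm_sub η₀ η
      rw [Metric.mem_ball, dist_eq_norm, norm_sub_rev] at hη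
      linarith
    have hβ' : |β| ≤ h := abs_le.2 hβ
    have he : ∀ z : ℂ, ‖z‖ ≤ (‖η₀‖ + 1) * h → ‖Complex.exp z‖ ≤ Real.exp ((‖η₀‖ + 1) * h) :=
      fun z hz => by
        rw [Complex.norm_exp]
        exact Real.exp_le_exp.2 ((Complex.re_le_norm z).trans hz)
    have hz : ‖η * β‖ ≤ (‖η₀‖ + 1) * h := by
      rw [norm_mul, Complex.norm_real, Real.norm_eq_abs]
      gcongr
    have hs : ‖Complex.sinh (η * β)‖ ≤ Real.exp ((‖η₀‖ + 1) * h) := by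
      rw [Complex.sinh, norm_div, Complex.norm_ofNat, div_le_iff₀ two_pos]
      refine (norm_sub_le _ _).trans ?_
      linarith [he _ hz, he (-(η * β)) (by rwa [norm_neg])]
    rw [norm_mul, norm_mul, Complex.norm_real, Real.norm_eq_abs]
    gcongr
  refine (intervalIntegral.hasDerivAt_integral_of_dominated_loc_of_deriv_le
    (μ := volume) (F := fun (η : ℂ) (β : ℝ) => g β * Complex.cosh (η * β))
    (F' := fun (η : ℂ) (β : ℝ) => g β * (β * Complex.sinh (η * β)))
    (bound := fun β => ‖g β‖ * (h * Real.exp ((‖η₀‖ + 1) * h)))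
    (Metric.ball_mem_nhds η₀ one_pos) (Eventually.of_forall fun η => ?_) ?_ ?_ ?_ ?_ ?_).2
  · exact (by fun_prop : Continuous fun β : ℝ => g β * Complex.cosh (η * β)).aestronglyMeasurable
  · exact (by fun_prop : Continuous fun β : ℝ => g β * Complex.cosh (η₀ * β)).intervalIntegrable _ _
  · exact (by fun_prop : Continuous fun β : ℝ =>
      g β * (β * Complex.sinh (η₀ * β))).aestronglyMeasurable
  · refine Eventually.of_forall fun β hβ η hη => hb η hη β ?_
    rw [Set.uIoc_of_le (by linarith)] at hβ
    exact ⟨hβ.1.le, hβ.2⟩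
  · exact (by fun_prop : Continuous fun β : ℝ =>
      ‖g β‖ * (h * Real.exp ((‖η₀‖ + 1) * h))).intervalIntegrable _ _
  · refine Eventually.of_forall fun β _ η _ => ?_
    have h1 : HasDerivAt (fun η : ℂ => η * (β : ℂ)) (β : ℂ) η := by
      simpa using (hasDerivAt_id η).mul_const (β : ℂ)
    refine (h1.ccosh.const_mul (g β)).congr_deriv ?_
    ring

theorem differentiable_auxA {h : ℝ} (hh : 0 ≤ h) (c₁ c₂ c₃ : ℝ) :
    Differentiable ℂ (auxA (2 * h) c₁ c₂ c₃) := by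
  have hcc := continuous_absExpKernel c₃
  rw [funext (auxA_eq_integral_absExpKernel h c₁ c₂ c₃)]
  intro η
  exact ((hasDerivAt_integral_mul_cosh (g := fun β => (absExpKernel c₃ β : ℂ)) (by fun_prop) hh
    η).differentiableAt.const_mul _).const_add _

theorem differentiable_auxB {h : ℝ} (hh : 0 ≤ h) (c₁ c₂ c₃ : ℝ) :
    Differentiable ℂ (auxB (2 * h) c₁ c₂ c₃) := by
  intro η
  have h1 := (hasDerivAt_integral_mul_cosh (g := fun β => ((Real.exp (-c₃ * |β|) : ℝ) : ℂ))
    (by fun_prop) hh η).differentiableAt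
  have h2 : auxB (2 * h) c₁ c₂ c₃ = fun η => η ^ 2 + 2 * (c₂ / c₁ : ℂ) - (c₃ : ℂ) ^ 2 -
      2 * (c₂ * c₃ / c₁ : ℂ) *
        ∫ β in (-h)..h, ((Real.exp (-c₃ * |β|) : ℝ) : ℂ) * Complex.cosh (η * β) := by
    funext η
    rw [auxB, show -(2 * h) / 2 = -h by ring, show 2 * h / 2 = h by ring]
    simp_rw [mul_comm]
  rw [h2]
  fun_prop

theorem differentiableAt_defect {c : ℝ} {η : ℂ} (hη : η ^ 2 ≠ (c : ℂ) ^ 2) (hc : (c : ℂ) ≠ 0)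
    (α : ℝ) : DifferentiableAt ℂ (fun η => defect c η α) η := by
  have h0 := sub_ne_zero.2 hη
  have h1 : (η ^ 2 - (c : ℂ) ^ 2) ^ 2 ≠ 0 := pow_ne_zero 2 h0
  have h2 : 2 * (c : ℂ) * (η ^ 2 - (c : ℂ) ^ 2) ≠ 0 := mul_ne_zero (mul_ne_zero two_ne_zero hc) h0
  unfold defect
  have h3 : DifferentiableAt ℂ (fun η : ℂ => Complex.cosh (η * α)) η := by fun_prop
  exact ((h3.sub_const _).div (by fun_prop) h1).sub ((differentiableAt_const _).div (by fun_prop) h2)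

theorem hasDerivAt_convOp_cosh {h c₁ c₂ c₃ : ℝ} (hh : 0 ≤ h) (α : ℝ) (η : ℂ) :
    HasDerivAt (fun η : ℂ => convOp c₁ c₂ c₃ h (fun β => Complex.cosh (η * β)) α)
      (convOp c₁ c₂ c₃ h (fun β => β * Complex.sinh (η * β)) α) η := by
  have hcc := continuous_absExpKernel c₃
  have h1 : HasDerivAt (fun η : ℂ => η * (α : ℂ)) (α : ℂ) η := by
    simpa using (hasDerivAt_id η).mul_const (α : ℂ)
  refine (h1.ccosh.const_mul (c₁ : ℂ)).add ((hasDerivAt_integral_mul_cosh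
    (g := fun β => (absExpKernel c₃ (α - β) : ℂ)) (by fun_prop) hh η).const_mul
      (c₂ : ℂ)) |>.congr_deriv ?_
  simp only [convOp]
  ring

/-- At a root of the characteristic polynomial the defect term of `convOp_cosh` vanishes. -/
theorem convOp_cosh_of_isRoot {h c₁ c₂ c₃ : ℝ} (hh : 0 ≤ h) (hc₁ : 0 < c₁) (hc₃ : 0 < c₃)
    {η : ℂ} (hη : η ^ 2 ≠ (c₃ : ℂ) ^ 2) (hroot : (charPoly c₁ c₂ c₃).IsRoot η) {α : ℝ}
    (hα : α ∈ Set.Icc (-h) h) :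
    convOp c₁ c₂ c₃ h (fun β => Complex.cosh (η * β)) α =
      c₁ * auxA (2 * h) c₁ c₂ c₃ η * Complex.cosh (c₃ * α) +
        c₁ * auxB (2 * h) c₁ c₂ c₃ η * (α * Complex.sinh (c₃ * α) / (2 * c₃)) := by
  rw [convOp_cosh hh hc₁ hc₃ hη hα, hroot.eq_zero, zero_mul, add_zero]

/-- At a double root `convOp_cosh` may be differentiated in `η`, and the defect term still vanishes. -/
theorem convOp_mul_sinh_of_double_root {h c₁ c₂ c₃ : ℝ} (hh : 0 ≤ h) (hc₁ : 0 < c₁) (hc₃ : 0 < c₃)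
    {η : ℂ} (hη : η ^ 2 ≠ (c₃ : ℂ) ^ 2) (hroot : (charPoly c₁ c₂ c₃).IsRoot η)
    (hroot' : (charPoly c₁ c₂ c₃).derivative.IsRoot η) {α : ℝ} (hα : α ∈ Set.Icc (-h) h) :
    convOp c₁ c₂ c₃ h (fun β => β * Complex.sinh (η * β)) α =
      c₁ * deriv (auxA (2 * h) c₁ c₂ c₃) η * Complex.cosh (c₃ * α) +
        c₁ * deriv (auxB (2 * h) c₁ c₂ c₃) η * (α * Complex.sinh (c₃ * α) / (2 * c₃)) := by
  have hc₃' : (c₃ : ℂ) ≠ 0 := by exact_mod_cast hc₃.ne'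
  have hA := (differentiable_auxA hh c₁ c₂ c₃ η).hasDerivAt
  have hB := (differentiable_auxB hh c₁ c₂ c₃ η).hasDerivAt
  have hQ := (differentiableAt_defect hη hc₃' α).hasDerivAt
  have hP := (charPoly c₁ c₂ c₃).hasDerivAt η
  have hrhs := (((hA.const_mul (c₁ : ℂ)).mul_const (Complex.cosh (c₃ * α))).add
    ((hB.const_mul (c₁ : ℂ)).mul_const (α * Complex.sinh (c₃ * α) / (2 * c₃)))).add (hP.mul hQ)
  have hev : ∀ᶠ z in 𝓝 η, z ^ 2 ≠ (c₃ : ℂ) ^ 2 :=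
    (continuous_pow 2).continuousAt.eventually_ne hη
  have hlhs := (hasDerivAt_convOp_cosh (c₁ := c₁) (c₂ := c₂) (c₃ := c₃) hh α η).congr_of_eventuallyEq
    (hev.mono fun z hz => (convOp_cosh hh hc₁ hc₃ hz hα).symm)
  refine (hlhs.unique hrhs).trans ?_
  rw [hroot.eq_zero, hroot'.eq_zero]
  simp

theorem convOp_add_add {h c₁ c₂ c₃ : ℝ} {u v w : ℝ → ℂ} (hu : Continuous u) (hv : Continuous v)
    (hw : Continuous w) (a b d : ℂ) (α : ℝ) :
    convOp c₁ c₂ c₃ h (fun β => a * u β + b * v β + d * w β) α =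
      a * convOp c₁ c₂ c₃ h u α + b * convOp c₁ c₂ c₃ h v α + d * convOp c₁ c₂ c₃ h w α := by
  have hcc := continuous_absExpKernel c₃
  have hi : ∀ {u : ℝ → ℂ} (e : ℂ), Continuous u → IntervalIntegrable
      (fun β => e * ((absExpKernel c₃ (α - β) : ℂ) * u β)) volume (-h) h := fun e hu =>
    (by fun_prop : Continuous _).intervalIntegrable _ _
  have : ∫ β in (-h)..h, (absExpKernel c₃ (α - β) : ℂ) * (a * u β + b * v β + d * w β) =
      a * (∫ β in (-h)..h, (absExpKernel c₃ (α - β) : ℂ) * u β) +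
      b * (∫ β in (-h)..h, (absExpKernel c₃ (α - β) : ℂ) * v β) +
      d * (∫ β in (-h)..h, (absExpKernel c₃ (α - β) : ℂ) * w β) := by
    simp only [← intervalIntegral.integral_const_mul]
    rw [← intervalIntegral.integral_add (hi a hu) (hi b hv),
      ← intervalIntegral.integral_add ((hi a hu).add (hi b hv)) (hi d hw)]
    refine intervalIntegral.integral_congr fun β _ => ?_
    ring
  simp only [convOp]
  rw [this]
  ring

/-- The image of the constant function, from `convOp_cosh` at `η = 0`. -/
theorem convOp_one {h c₁ c₂ c₃ : ℝ} (hh : 0 ≤ h) (hc₁ : 0 < c₁) (hc₂ : 0 < c₂) (hc₃ : 0 < c₃)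
    {α : ℝ} (hα : α ∈ Set.Icc (-h) h) :
    (c₃ : ℂ) ^ 2 / (2 * c₂ + c₃ ^ 2 * c₁) * convOp c₁ c₂ c₃ h (fun _ => 1) α = 1 -
      c₁ * (1 / c₁ - auxA (2 * h) c₁ c₂ c₃ 0 * c₃ ^ 2 / (2 * c₂ + c₃ ^ 2 * c₁)) *
        Complex.cosh (c₃ * α) +
      c₁ * (c₃ ^ 2 / c₁ + auxB (2 * h) c₁ c₂ c₃ 0 * c₃ ^ 2 / (2 * c₂ + c₃ ^ 2 * c₁)) *
        (α * Complex.sinh (c₃ * α) / (2 * c₃)) := by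
  have hc₁' : (c₁ : ℂ) ≠ 0 := by exact_mod_cast hc₁.ne'
  have hc₃' : (c₃ : ℂ) ≠ 0 := by exact_mod_cast hc₃.ne'
  have hS : (2 * c₂ + c₃ ^ 2 * c₁ : ℂ) ≠ 0 := by
    have : (0 : ℝ) < 2 * c₂ + c₃ ^ 2 * c₁ := by positivity
    exact_mod_cast this.ne'
  have h1 := convOp_cosh (c₂ := c₂) hh hc₁ hc₃ (η := 0)
    (by rw [zero_pow two_ne_zero]; exact (pow_ne_zero 2 hc₃').symm) hα
  simp only [zero_mul, Complex.cosh_zero] at h1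
  rw [h1, charPoly_eval, defect]
  simp only [zero_mul, Complex.cosh_zero, ne_eq, OfNat.ofNat_ne_zero, not_false_eq_true, zero_pow,
    mul_zero, zero_add, zero_sub]
  field_simp
  ring

/-- If `u` and `v` are linearly independent and `convOp` maps them to combinations of `cosh(c₃α)` and
`α sinh(c₃α)`, then the coefficient determinant is nonzero, and the equation `convOp · = 1` has an
explicit solution among the combinations of `u`, `v` and `1`. -/
theorem det_ne_zero_and_kernel_value {h c₁ c₂ c₃ : ℝ} (hh : 0 ≤ h) (hc₁ : 0 < c₁) (hc₂ : 0 < c₂)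
    (hc₃ : 0 < c₃) {k₀ : ℂ}
    (hval : ∀ u : ℝ → ℂ, Continuous u → (∀ α ∈ Set.Icc (-h) h, convOp c₁ c₂ c₃ h u α = 1) →
        k₀ = ∫ α in (-h)..h, u α)
    (hinj : ∀ u : ℝ → ℂ, Continuous u → (∀ α ∈ Set.Icc (-h) h, convOp c₁ c₂ c₃ h u α = 0) →
        ∀ α ∈ Set.Icc (-h) h, u α = 0)
    {u v : ℝ → ℂ} (hu : Continuous u) (hv : Continuous v)
    (hindep : ∀ a b : ℂ, (∀ α ∈ Set.Icc (-h) h, a * u α + b * v α = 0) → a = 0 ∧ b = 0)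
    {A₁ A₂ B₁ B₂ : ℂ}
    (h1 : ∀ α ∈ Set.Icc (-h) h, convOp c₁ c₂ c₃ h u α = c₁ * A₁ * Complex.cosh (c₃ * α) +
      c₁ * B₁ * (α * Complex.sinh (c₃ * α) / (2 * c₃)))
    (h2 : ∀ α ∈ Set.Icc (-h) h, convOp c₁ c₂ c₃ h v α = c₁ * A₂ * Complex.cosh (c₃ * α) +
      c₁ * B₂ * (α * Complex.sinh (c₃ * α) / (2 * c₃))) :
    A₁ * B₂ - B₁ * A₂ ≠ 0 ∧ k₀ =
      (1 / (c₁ : ℂ) - auxA (2 * h) c₁ c₂ c₃ 0 * (c₃ : ℂ) ^ 2 / (2 * c₂ + (c₃ : ℂ) ^ 2 * c₁)) *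
        (((∫ α in (-h)..h, u α) * B₂ - (∫ α in (-h)..h, v α) * B₁) / (A₁ * B₂ - B₁ * A₂)) +
      ((c₃ : ℂ) ^ 2 / c₁ + auxB (2 * h) c₁ c₂ c₃ 0 * (c₃ : ℂ) ^ 2 / (2 * c₂ + (c₃ : ℂ) ^ 2 * c₁)) *
        (((∫ α in (-h)..h, u α) * A₂ - (∫ α in (-h)..h, v α) * A₁) / (A₁ * B₂ - B₁ * A₂)) +
      (2 * h : ℝ) * (c₃ : ℂ) ^ 2 / (2 * c₂ + (c₃ : ℂ) ^ 2 * c₁) := by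
  have hlin : ∀ a b d : ℂ, ∀ α ∈ Set.Icc (-h) h,
      convOp c₁ c₂ c₃ h (fun β => a * u β + b * v β + d * 1) α =
      c₁ * (a * A₁ + b * A₂) * Complex.cosh (c₃ * α) +
      c₁ * (a * B₁ + b * B₂) * (α * Complex.sinh (c₃ * α) / (2 * c₃)) +
      d * convOp c₁ c₂ c₃ h (fun _ => 1) α := by
    intro a b d α hα
    rw [convOp_add_add hu hv continuous_const, h1 α hα, h2 α hα]
    ring
  -- a combination whose two coefficients vanish is annihilated by the operator
  have htriv : ∀ a b : ℂ, a * A₁ + b * A₂ = 0 → a * B₁ + b * B₂ = 0 → a = 0 ∧ b = 0 := by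
    intro a b hA hB
    refine hindep a b fun α hα => ?_
    have := hinj (fun β => a * u β + b * v β + 0 * 1) (by fun_prop) (fun α hα => by
      rw [hlin a b 0 α hα, hA, hB]; ring) α hα
    simpa using this
  have hD : A₁ * B₂ - B₁ * A₂ ≠ 0 := by
    intro hD
    -- the rows of a singular coefficient matrix give annihilated combinations
    obtain ⟨hB₂, hB₁⟩ := htriv B₂ (-B₁) (by linear_combination hD) (by ring)
    obtain ⟨hA₂, hA₁⟩ := htriv A₂ (-A₁) (by ring) (by linear_combination -hD)
    rw [neg_eq_zero] at hB₁ hA₁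
    exact one_ne_zero (htriv 1 0 (by rw [hA₁]; ring) (by rw [hB₁]; ring)).1
  refine ⟨hD, ?_⟩
  have hT := fun α hα => convOp_one (h := h) hh hc₁ hc₂ hc₃ (α := α) hα
  set S : ℂ := 2 * c₂ + (c₃ : ℂ) ^ 2 * c₁ with hS
  set r₁ : ℂ := 1 / (c₁ : ℂ) - auxA (2 * h) c₁ c₂ c₃ 0 * (c₃ : ℂ) ^ 2 / S with hr₁
  set r₂ : ℂ := (c₃ : ℂ) ^ 2 / c₁ + auxB (2 * h) c₁ c₂ c₃ 0 * (c₃ : ℂ) ^ 2 / S with hr₂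
  set D : ℂ := A₁ * B₂ - B₁ * A₂ with hDdef
  have hk := hval (fun β => (r₁ * B₂ + r₂ * A₂) / D * u β + (-(r₁ * B₁ + r₂ * A₁)) / D * v β +
    (c₃ : ℂ) ^ 2 / S * 1) (by fun_prop) (fun α hα => by
      rw [hlin _ _ _ α hα, hT α hα]
      have e1 : (r₁ * B₂ + r₂ * A₂) / D * A₁ + (-(r₁ * B₁ + r₂ * A₁)) / D * A₂ = r₁ := by
        rw [div_mul_eq_mul_div, div_mul_eq_mul_div, ← add_div, div_eq_iff hD, hDdef]; ring
      have e2 : (r₁ * B₂ + r₂ * A₂) / D * B₁ + (-(r₁ * B₁ + r₂ * A₁)) / D * B₂ = -r₂ := by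
        rw [div_mul_eq_mul_div, div_mul_eq_mul_div, ← add_div, div_eq_iff hD, hDdef]; ring
      rw [e1, e2]; ring)
  have hi : ∀ {u : ℝ → ℂ} (e : ℂ), Continuous u → IntervalIntegrable
      (fun β => e * u β) volume (-h) h := fun e hu =>
    (by fun_prop : Continuous _).intervalIntegrable _ _
  rw [intervalIntegral.integral_add ((hi _ hu).add (hi _ hv)) (hi _ continuous_const),
    intervalIntegral.integral_add (hi _ hu) (hi _ hv)] at hk
  simp only [intervalIntegral.integral_const_mul] at hk
  rw [hk, intervalIntegral.integral_const]
  rw [Complex.real_smul]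
  push_cast
  ring

theorem second_deriv_eq_zero {h : ℝ} (hh : 0 < h) {f f' : ℝ → ℂ} {f'' : ℂ}
    (hf : ∀ x, HasDerivAt f (f' x) x) (hf' : HasDerivAt f' f'' 0)
    (h0 : ∀ x ∈ Set.Icc (-h) h, f x = 0) : f'' = 0 := by
  have hmem : Set.Ioo (-h) h ∈ 𝓝 (0 : ℝ) := Ioo_mem_nhds (by linarith) hh
  have h1 : ∀ x ∈ Set.Ioo (-h) h, f' x = 0 := fun x hx => by
    refine (hf x).unique ((hasDerivAt_const x (0 : ℂ)).congr_of_eventuallyEq ?_)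
    filter_upwards [Ioo_mem_nhds hx.1 hx.2] with y hy
    exact h0 y ⟨hy.1.le, hy.2.le⟩
  refine hf'.unique ((hasDerivAt_const (0 : ℝ) (0 : ℂ)).congr_of_eventuallyEq ?_)
  filter_upwards [hmem] with y hy
  exact h1 y hy

theorem hasDerivAt_cosh_mul_ofReal (η : ℂ) (x : ℝ) :
    HasDerivAt (fun x : ℝ => Complex.cosh (η * x)) (Complex.sinh (η * x) * η) x := by
  have h0 : HasDerivAt (fun x : ℝ => η * (x : ℂ)) (η * 1) x :=
    Complex.ofRealCLM.hasDerivAt.const_mul η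
  have := (Complex.hasDerivAt_cosh (η * x)).comp x h0
  simpa [Function.comp_def] using this

theorem hasDerivAt_sinh_mul_ofReal (η : ℂ) (x : ℝ) :
    HasDerivAt (fun x : ℝ => Complex.sinh (η * x)) (Complex.cosh (η * x) * η) x := by
  have h0 : HasDerivAt (fun x : ℝ => η * (x : ℂ)) (η * 1) x :=
    Complex.ofRealCLM.hasDerivAt.const_mul η
  have := (Complex.hasDerivAt_sinh (η * x)).comp x h0
  simpa [Function.comp_def] using this

theorem cosh_cosh_independent {h : ℝ} (hh : 0 < h) {η₁ η₂ : ℂ} (hne : η₁ ^ 2 ≠ η₂ ^ 2) (a b : ℂ)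
    (h0 : ∀ α ∈ Set.Icc (-h) h, a * Complex.cosh (η₁ * (α : ℝ)) + b * Complex.cosh (η₂ * α) = 0) :
    a = 0 ∧ b = 0 := by
  have e0 := h0 0 ⟨by linarith, hh.le⟩
  simp only [Complex.ofReal_zero, mul_zero, Complex.cosh_zero, mul_one] at e0
  have e2 := second_deriv_eq_zero hh (fun x => ((hasDerivAt_cosh_mul_ofReal η₁ x).const_mul a).add
    ((hasDerivAt_cosh_mul_ofReal η₂ x).const_mul b))
    ((((hasDerivAt_sinh_mul_ofReal η₁ 0).mul_const η₁).const_mul a).add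
    (((hasDerivAt_sinh_mul_ofReal η₂ 0).mul_const η₂).const_mul b)) h0
  simp only [Complex.ofReal_zero, mul_zero, Complex.cosh_zero, one_mul] at e2
  have ha : a * (η₁ ^ 2 - η₂ ^ 2) = 0 := by linear_combination e2 - η₂ ^ 2 * e0
  have ha0 : a = 0 := (mul_eq_zero.1 ha).resolve_right (sub_ne_zero.2 hne)
  exact ⟨ha0, by rw [ha0, zero_add] at e0; exact e0⟩

theorem cosh_mul_sinh_independent {h : ℝ} (hh : 0 < h) {η : ℂ} (hne : η ≠ 0) (a b : ℂ)
    (h0 : ∀ α ∈ Set.Icc (-h) h,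
      a * Complex.cosh (η * (α : ℝ)) + b * (α * Complex.sinh (η * α)) = 0) :
    a = 0 ∧ b = 0 := by
  have e0 := h0 0 ⟨by linarith, hh.le⟩
  simp only [Complex.ofReal_zero, mul_zero, Complex.cosh_zero, mul_one, zero_mul, add_zero] at e0
  have hid : ∀ x : ℝ, HasDerivAt (fun x : ℝ => (x : ℂ)) 1 x := fun x =>
    Complex.ofRealCLM.hasDerivAt
  have e2 := second_deriv_eq_zero hh (fun x => ((hasDerivAt_cosh_mul_ofReal η x).const_mul a).add
    (((hid x).mul (hasDerivAt_sinh_mul_ofReal η x)).const_mul b))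
    ((((hasDerivAt_sinh_mul_ofReal η 0).mul_const η).const_mul a).add
    ((((hasDerivAt_sinh_mul_ofReal η 0).const_mul 1).add
      ((hid 0).mul ((hasDerivAt_cosh_mul_ofReal η 0).mul_const η))).const_mul b)) h0
  simp only [Complex.ofReal_zero, mul_zero, Complex.cosh_zero, one_mul, Complex.sinh_zero,
    zero_mul, add_zero, e0, zero_add] at e2
  refine ⟨e0, ?_⟩
  have : b * (2 * η) = 0 := by linear_combination e2
  exact (mul_eq_zero.1 this).resolve_right (mul_ne_zero two_ne_zero hne)

theorem integral_cosh_mul {h : ℝ} {η : ℂ} (hη : η ≠ 0) :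
    ∫ α in (-h)..h, Complex.cosh (η * (α : ℝ)) = 2 * (Complex.sinh (h * η) / η) := by
  have hc := Complex.continuous_cosh
  rw [intervalIntegral.integral_eq_sub_of_hasDerivAt
    (f := fun x : ℝ => Complex.sinh (η * x) / η) (fun x _ =>
      ((hasDerivAt_sinh_mul_ofReal η x).div_const η).congr_deriv (by field_simp))
    ((by fun_prop : Continuous fun x : ℝ => Complex.cosh (η * x)).intervalIntegrable _ _)]
  push_cast
  rw [mul_neg, Complex.sinh_neg, mul_comm η]
  ring

/-- The divided difference of an antisymmetric expression tends to the Wronskian. -/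
theorem tendsto_antisymm_div {f g : ℂ → ℂ} (hf : Differentiable ℂ f) (hg : Differentiable ℂ g)
    (η : ℂ) :
    Tendsto (fun p : ℂ × ℂ => (f p.1 * g p.2 - f p.2 * g p.1) / (p.2 - p.1))
      (𝓝[{p : ℂ × ℂ | p.1 ≠ p.2}] (η, η)) (𝓝 (f η * deriv g η - deriv f η * g η)) := by
  have hslope : ∀ {f : ℂ → ℂ}, Differentiable ℂ f → Tendsto (fun p : ℂ × ℂ =>
      (f p.2 - f p.1) / (p.2 - p.1)) (𝓝[{p : ℂ × ℂ | p.1 ≠ p.2}] (η, η)) (𝓝 (deriv f η)) := by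
    intro f hf
    have h1 : HasStrictDerivAt f (deriv f η) η := (hf.analyticAt η).hasStrictDerivAt
    have h2 := h1.isLittleO.tendsto_div_nhds_zero
    have h3 := (h2.mono_left nhdsWithin_le_nhds :
      Tendsto _ (𝓝[{p : ℂ × ℂ | p.1 ≠ p.2}] (η, η)) _).add_const (deriv f η)
    rw [zero_add] at h3
    refine h3.congr' ?_
    filter_upwards [self_mem_nhdsWithin] with p hp
    have hp' : p.1 - p.2 ≠ 0 := sub_ne_zero.2 hp
    have hp'' : p.2 - p.1 ≠ 0 := sub_ne_zero.2 (Ne.symm hp)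
    simp only [ContinuousLinearMap.toSpanSingleton_apply, smul_eq_mul]
    rw [div_add' _ _ _ hp', div_eq_div_iff hp' hp'']
    ring
  have hc : ∀ {f : ℂ → ℂ}, Differentiable ℂ f → Tendsto (fun p : ℂ × ℂ => f p.1)
      (𝓝[{p : ℂ × ℂ | p.1 ≠ p.2}] (η, η)) (𝓝 (f η)) := fun hf =>
    ((hf.continuous.comp continuous_fst).tendsto (η, η)).mono_left nhdsWithin_le_nhds
  refine (((hc hf).mul (hslope hg)).sub ((hslope hf).mul (hc hg))).congr fun p => ?_
  ring

/-! ### The value at the origin -/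

theorem charPoly_root_ne_zero {c₁ c₂ c₃ : ℝ} (hc₁ : 0 < c₁) (hc₂ : 0 < c₂) (hc₃ : 0 < c₃) {η : ℂ}
    (hη : (charPoly c₁ c₂ c₃).IsRoot η) : η ≠ 0 := by
  rintro rfl
  have h1 := hη.eq_zero
  rw [charPoly_eval] at h1
  have : (0 : ℝ) < c₃ ^ 2 * (2 * c₂ + c₁ * c₃ ^ 2) := by positivity
  refine this.ne' ?_
  exact_mod_cast (by linear_combination h1 : (c₃ : ℂ) ^ 2 * (2 * c₂ + c₁ * c₃ ^ 2) = 0)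

theorem charPoly_root_sq_ne {c₁ c₂ c₃ : ℝ} (hc₂ : 0 < c₂) (hc₃ : 0 < c₃) {η : ℂ}
    (hη : (charPoly c₁ c₂ c₃).IsRoot η) : η ^ 2 ≠ (c₃ : ℂ) ^ 2 := by
  intro hsq
  have h1 := hη.eq_zero
  rw [charPoly_eval] at h1
  have : (0 : ℝ) < 4 * c₂ * c₃ ^ 2 := by positivity
  refine this.ne' ?_
  have h2 : 4 * (c₂ : ℂ) * c₃ ^ 2 = 0 := by
    linear_combination h1 - (c₁ * (η ^ 2 + c₃ ^ 2) + 2 * (c₂ - c₁ * c₃ ^ 2)) * hsq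
  exact_mod_cast h2

/-- The integral of `cosh(ηα)` over `[-h, h]`. -/
def coshIntegral (h : ℝ) (η : ℂ) : ℂ := ∫ α in (-h)..h, Complex.cosh (η * (α : ℝ))

theorem hasDerivAt_coshIntegral {h : ℝ} (hh : 0 ≤ h) (η : ℂ) :
    HasDerivAt (coshIntegral h) (∫ α in (-h)..h, (α : ℂ) * Complex.sinh (η * α)) η := by
  have := hasDerivAt_integral_mul_cosh (g := fun _ => 1) continuous_const hh η
  simp only [one_mul] at this
  exact this

/-- `kernelExpr` in the form that `det_ne_zero_and_kernel_value` produces. -/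
theorem kernelExpr_eq {h c₁ c₂ c₃ : ℝ} {x y : ℂ} (hx : x ≠ 0) (hy : y ≠ 0) :
    kernelExpr (2 * h) c₁ c₂ c₃ x y =
      (1 / (c₁ : ℂ) - auxA (2 * h) c₁ c₂ c₃ 0 * (c₃ : ℂ) ^ 2 / (2 * c₂ + (c₃ : ℂ) ^ 2 * c₁)) *
        ((coshIntegral h x * auxB (2 * h) c₁ c₂ c₃ y -
          coshIntegral h y * auxB (2 * h) c₁ c₂ c₃ x) / detAB (2 * h) c₁ c₂ c₃ x y) +
      ((c₃ : ℂ) ^ 2 / c₁ + auxB (2 * h) c₁ c₂ c₃ 0 * (c₃ : ℂ) ^ 2 / (2 * c₂ + (c₃ : ℂ) ^ 2 * c₁)) *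
        ((coshIntegral h x * auxA (2 * h) c₁ c₂ c₃ y -
          coshIntegral h y * auxA (2 * h) c₁ c₂ c₃ x) / detAB (2 * h) c₁ c₂ c₃ x y) +
      (2 * h : ℝ) * (c₃ : ℂ) ^ 2 / (2 * c₂ + (c₃ : ℂ) ^ 2 * c₁) := by
  rw [kernelExpr, coshIntegral, coshIntegral, integral_cosh_mul hx, integral_cosh_mul hy]
  push_cast
  rw [show 2 * (h : ℂ) * x / 2 = h * x by ring, show 2 * (h : ℂ) * y / 2 = h * y by ring]
  ring

/-- The limit of `kernelExpr` on the diagonal, with Wronskians in place of determinants. -/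
theorem tendsto_kernelExpr {h c₁ c₂ c₃ : ℝ} (hh : 0 ≤ h) {η : ℂ} (hη : η ≠ 0)
    (hW : auxA (2 * h) c₁ c₂ c₃ η * deriv (auxB (2 * h) c₁ c₂ c₃) η -
      auxB (2 * h) c₁ c₂ c₃ η * deriv (auxA (2 * h) c₁ c₂ c₃) η ≠ 0) :
    (∀ᶠ p : ℂ × ℂ in 𝓝[{p : ℂ × ℂ | p.1 ≠ p.2}] (η, η), detAB (2 * h) c₁ c₂ c₃ p.1 p.2 ≠ 0) ∧
    Tendsto (fun p : ℂ × ℂ => kernelExpr (2 * h) c₁ c₂ c₃ p.1 p.2)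
      (𝓝[{p : ℂ × ℂ | p.1 ≠ p.2}] (η, η)) (𝓝 (
      (1 / (c₁ : ℂ) - auxA (2 * h) c₁ c₂ c₃ 0 * (c₃ : ℂ) ^ 2 / (2 * c₂ + (c₃ : ℂ) ^ 2 * c₁)) *
        ((coshIntegral h η * deriv (auxB (2 * h) c₁ c₂ c₃) η -
          deriv (coshIntegral h) η * auxB (2 * h) c₁ c₂ c₃ η) /
          (auxA (2 * h) c₁ c₂ c₃ η * deriv (auxB (2 * h) c₁ c₂ c₃) η -
            auxB (2 * h) c₁ c₂ c₃ η * deriv (auxA (2 * h) c₁ c₂ c₃) η)) +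
      ((c₃ : ℂ) ^ 2 / c₁ + auxB (2 * h) c₁ c₂ c₃ 0 * (c₃ : ℂ) ^ 2 / (2 * c₂ + (c₃ : ℂ) ^ 2 * c₁)) *
        ((coshIntegral h η * deriv (auxA (2 * h) c₁ c₂ c₃) η -
          deriv (coshIntegral h) η * auxA (2 * h) c₁ c₂ c₃ η) /
          (auxA (2 * h) c₁ c₂ c₃ η * deriv (auxB (2 * h) c₁ c₂ c₃) η -
            auxB (2 * h) c₁ c₂ c₃ η * deriv (auxA (2 * h) c₁ c₂ c₃) η)) +
      (2 * h : ℝ) * (c₃ : ℂ) ^ 2 / (2 * c₂ + (c₃ : ℂ) ^ 2 * c₁))) := by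
  have hS : Differentiable ℂ (coshIntegral h) := fun η =>
    (hasDerivAt_coshIntegral hh η).differentiableAt
  have hA := differentiable_auxA hh c₁ c₂ c₃
  have hB := differentiable_auxB hh c₁ c₂ c₃
  have hne : ∀ᶠ p : ℂ × ℂ in 𝓝[{p : ℂ × ℂ | p.1 ≠ p.2}] (η, η), p.2 - p.1 ≠ 0 := by
    filter_upwards [self_mem_nhdsWithin] with p hp
    exact sub_ne_zero.2 (Ne.symm hp)
  have t0 : Tendsto (fun p : ℂ × ℂ => detAB (2 * h) c₁ c₂ c₃ p.1 p.2 / (p.2 - p.1))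
      (𝓝[{p : ℂ × ℂ | p.1 ≠ p.2}] (η, η))
      (𝓝 (auxA (2 * h) c₁ c₂ c₃ η * deriv (auxB (2 * h) c₁ c₂ c₃) η -
        auxB (2 * h) c₁ c₂ c₃ η * deriv (auxA (2 * h) c₁ c₂ c₃) η)) := by
    have := tendsto_antisymm_div hA hB η
    rw [mul_comm (deriv _ _)] at this
    refine this.congr fun p => ?_
    rw [detAB, mul_comm (auxB _ _ _ _ p.1)]
  have hdet : ∀ᶠ p : ℂ × ℂ in 𝓝[{p : ℂ × ℂ | p.1 ≠ p.2}] (η, η),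
      detAB (2 * h) c₁ c₂ c₃ p.1 p.2 ≠ 0 := by
    filter_upwards [t0.eventually_ne hW] with p hp h0
    exact hp (by rw [h0, zero_div])
  refine ⟨hdet, ?_⟩
  have t1 := (tendsto_antisymm_div hS hB η).div t0 hW
  have t2 := (tendsto_antisymm_div hS hA η).div t0 hW
  have hn : ∀ᶠ p : ℂ × ℂ in 𝓝[{p : ℂ × ℂ | p.1 ≠ p.2}] (η, η), p.1 ≠ 0 ∧ p.2 ≠ 0 :=
    ((continuous_fst.continuousAt.eventually_ne (x := (η, η)) hη).and
      (continuous_snd.continuousAt.eventually_ne (x := (η, η)) hη)).filter_mono nhdsWithin_le_nhds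
  refine (((t1.const_mul _).add (t2.const_mul _)).add_const _).congr' ?_
  filter_upwards [hn, hne] with p hp hp'
  rw [kernelExpr_eq hp.1 hp.2]
  simp only [Pi.div_apply]
  rw [div_div_div_cancel_right₀ hp', div_div_div_cancel_right₀ hp']

end

theorem theorem5 (Δ c₁ c₂ c₃ : ℝ) (hΔ : 0 < Δ) (hc₁ : 0 < c₁) (hc₂ : 0 < c₂) (hc₃ : 0 < c₃)
    (hbound : c₂ / c₁ * Δ ^ 2 ≤ 5 / 3) :
    ∃ K : ℂ → ℂ → ℂ,
      IsReproducingKernel Δ (nuMeasure Δ c₁ c₂ c₃) K ∧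
      (∀ K' : ℂ → ℂ → ℂ, IsReproducingKernel Δ (nuMeasure Δ c₁ c₂ c₃) K' → K' = K) ∧
      ∀ η₁ η₂ : ℂ, (charPoly c₁ c₂ c₃).IsRoot η₁ → (charPoly c₁ c₂ c₃).IsRoot η₂ →
        η₁ + η₂ ≠ 0 →
        (η₁ ≠ η₂ →
          detAB Δ c₁ c₂ c₃ η₁ η₂ ≠ 0 ∧ K 0 0 = kernelExpr Δ c₁ c₂ c₃ η₁ η₂) ∧
        (η₁ = η₂ → 2 ≤ (charPoly c₁ c₂ c₃).rootMultiplicity η₁ →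
          (∀ᶠ p : ℂ × ℂ in 𝓝[{p : ℂ × ℂ | p.1 ≠ p.2}] (η₁, η₂),
            detAB Δ c₁ c₂ c₃ p.1 p.2 ≠ 0) ∧
          Tendsto (fun p : ℂ × ℂ => kernelExpr Δ c₁ c₂ c₃ p.1 p.2)
            (𝓝[{p : ℂ × ℂ | p.1 ≠ p.2}] (η₁, η₂)) (𝓝 (K 0 0))) := by
  obtain ⟨h, rfl⟩ : ∃ h, Δ = 2 * h := ⟨Δ / 2, by ring⟩
  have hh : 0 < h := by linarith
  have hcosh := Complex.continuous_cosh
  have hsinh := Complex.continuous_sinh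
  obtain ⟨K, hK, huniq, hval, hinj⟩ :=
    exists_reproducingKernel_nuMeasure hh hc₁ hc₂ hc₃ hbound
  refine ⟨K, hK, huniq, fun η₁ η₂ hr₁ hr₂ hsum => ⟨fun hne => ?_, ?_⟩⟩
  · have hsq : η₁ ^ 2 ≠ η₂ ^ 2 := fun hsq => by
      rcases sq_eq_sq_iff_eq_or_eq_neg.1 hsq with h1 | h1
      · exact hne h1
      · exact hsum (by rw [h1]; ring)
    obtain ⟨hD, hk⟩ := det_ne_zero_and_kernel_value hh.le hc₁ hc₂ hc₃ hval hinj
      (u := fun β : ℝ => Complex.cosh (η₁ * β)) (v := fun β : ℝ => Complex.cosh (η₂ * β))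
      (by fun_prop) (by fun_prop) (cosh_cosh_independent hh hsq)
      (fun α hα => convOp_cosh_of_isRoot hh.le hc₁ hc₃ (charPoly_root_sq_ne hc₂ hc₃ hr₁) hr₁ hα)
      (fun α hα => convOp_cosh_of_isRoot hh.le hc₁ hc₃ (charPoly_root_sq_ne hc₂ hc₃ hr₂) hr₂ hα)
    refine ⟨hD, hk.trans ?_⟩
    rw [kernelExpr_eq (charPoly_root_ne_zero hc₁ hc₂ hc₃ hr₁)
      (charPoly_root_ne_zero hc₁ hc₂ hc₃ hr₂)]
    rfl
  · rintro rfl hmult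
    have hroot' := (Polynomial.one_lt_rootMultiplicity_iff_isRoot (fun h0 => by
      rw [h0, Polynomial.rootMultiplicity_zero] at hmult; omega)).1 hmult
    have hη := charPoly_root_ne_zero hc₁ hc₂ hc₃ hr₁
    have hη' := charPoly_root_sq_ne hc₂ hc₃ hr₁
    obtain ⟨hD, hk⟩ := det_ne_zero_and_kernel_value hh.le hc₁ hc₂ hc₃ hval hinj
      (u := fun β : ℝ => Complex.cosh (η₁ * β)) (v := fun β : ℝ => β * Complex.sinh (η₁ * β))
      (by fun_prop) (by fun_prop) (cosh_mul_sinh_independent hh hη)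
      (fun α hα => convOp_cosh_of_isRoot hh.le hc₁ hc₃ hη' hr₁ hα)
      (fun α hα => convOp_mul_sinh_of_double_root hh.le hc₁ hc₃ hη' hr₁ hroot'.2 hα)
    obtain ⟨hdet, ht⟩ := tendsto_kernelExpr hh.le hη hD
    refine ⟨hdet, ?_⟩
    rw [hk, ← (hasDerivAt_coshIntegral hh.le η₁).deriv]
    exact ht
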